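/- Let $N$ be an odd-dimensional smooth manifold. An almost contact metric structure $(g,\xi,\eta,\varphi)$ on $N$ consists of a Riemannian metric $g$, a unit vector field $\xi$, its dual $1$-form $\eta=g(\xi,\cdot)$ and an endomorphism $\varphi$ of $TN$ with $\varphi(\xi)=0$, $\varphi^2=-1+\eta\otimes\xi$ and $g(\varphi X,\varphi Y)=g(X,Y)-\eta(X)\eta(Y)$. It is *normal* if $$[\varphi X,\varphi Y]+\varphi^2[X,Y]-\varphi[\varphi X,Y]-\varphi[X,\varphi Y]+d\eta(X,Y)\,\xi=0$$ for all vector fields $X,Y$, where $d\eta(X,Y)=X\eta(Y)-Y\eta(X)-\eta([X,Y])$. It is *ST* (Sasaki with torsion) if it is normal and $\xi$ is a Killing field. Put $F=g(\varphi\cdot,\cdot)$ and $d^\varphi F=dF(\varphi\cdot,\varphi\cdot,\varphi\cdot)$. A normal almost contact metric structure is *Sasaki* if $d\eta=2F$. An almost Hermitian manifold $(M,g,J)$ is *KT* with torsion $3$-form $c$ if $J$ is integrable (its Nijenhuis tensor vanishes) and there is a connection $\nabla$ on $TM$ with $\nabla g=0=\nabla J$ and $g(\nabla_XY-\nabla_YX-[X,Y],Z)=c(X,Y,Z)$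 for all $X,Y,Z$. It is *SKT* if it is KT with a torsion $3$-form $c$ such that $dc=0$. **Proposition.** Let $(N,g,\xi,\eta,\varphi)$ be an ST manifold. On the Riemannian cone $\mathcal C(N)=\mathbb R_+\times N$, $g_{\mathcal C}=dr^2+r^2g$, let $J_{\mathcal C}$ be the almost complex structure given by $J_{\mathcal C}\,\partial_r=\xi/r$, $J_{\mathcal C}\,\xi=-r\,\partial_r$ and $J_{\mathcal C}=\varphi$ on $\ker\eta\subset TN$. Then $g_{\mathcal C}(J_{\mathcal C}\cdot,\cdot)=\omega_{\mathcal C}$ with $\omega_{\mathcal C}=r\,dr\wedge\eta+r^2F$. Moreover: 1. $(\mathcal C(N),g_{\mathcal C},J_{\mathcal C})$ is KT with torsion $3$-form $r^2\bigl(\eta\wedge(d\eta-2F)+d^\varphi F\bigr)$; 2. $(\mathcal C(N),g_{\mathcal C},J_{\mathcal C})$ is SKT if and only if $(N,g,\xi,\eta,\varphi)$ is Sasaki. -/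

import Mathlib

open scoped Manifold ContDiff Bundle Topology
open Set Bundle Module

noncomputable section

namespace TorsionGeometry

section Forms

variable {V : Type*} [AddCommGroup V] [Module ℝ V] [TopologicalSpace V]

/-- `α ∧ β` for a `1`-form `α` and a `k`-form `β`, without normalizing factor:
`(α ∧ β)(v₀, …, v_k) = ∑ i, (-1) ^ i α(v_i) β(v₀, …, v_k without v_i)`. -/
def wedge {k : ℕ} (α : V →L[ℝ] ℝ) (β : V [⋀^Fin k]→L[ℝ] ℝ) : V [⋀^Fin (k + 1)]→L[ℝ] ℝ where
  toMultilinearMap := (AlternatingMap.alternatizeUncurryFin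
    ((α : V →ₗ[ℝ] ℝ).smulRight β.toAlternatingMap)).toMultilinearMap
  map_eq_zero_of_eq' := (AlternatingMap.alternatizeUncurryFin
    ((α : V →ₗ[ℝ] ℝ).smulRight β.toAlternatingMap)).map_eq_zero_of_eq'
  cont := by
    have h : ∀ v : Fin (k + 1) → V, AlternatingMap.alternatizeUncurryFin
        ((α : V →ₗ[ℝ] ℝ).smulRight β.toAlternatingMap) v =
        ∑ i : Fin (k + 1), (-1 : ℤ) ^ (i : ℕ) • (α (v i) * β (i.removeNth v)) := by
      intro v
      simp [AlternatingMap.alternatizeUncurryFin_apply]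
    refine Continuous.congr (f := fun v : Fin (k + 1) → V =>
      ∑ i : Fin (k + 1), (-1 : ℤ) ^ (i : ℕ) • (α (v i) * β (i.removeNth v))) ?_
      (fun v => (h v).symm)
    refine continuous_finsetSum _ fun i _ => Continuous.zsmul ?_ _
    refine (α.continuous.comp (continuous_apply i)).mul (β.cont.comp ?_)
    exact continuous_pi fun j => continuous_apply _

theorem wedge_apply {k : ℕ} (α : V →L[ℝ] ℝ) (β : V [⋀^Fin k]→L[ℝ] ℝ) (v : Fin (k + 1) → V) :
    wedge α β v = ∑ i : Fin (k + 1), (-1 : ℝ) ^ (i : ℕ) * (α (v i) * β (i.removeNth v)) := by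
  have : wedge α β v = AlternatingMap.alternatizeUncurryFin
    ((α : V →ₗ[ℝ] ℝ).smulRight β.toAlternatingMap) v := rfl
  rw [this, AlternatingMap.alternatizeUncurryFin_apply]
  simp

/-- A continuous linear functional as a `1`-form. -/
def oneForm (α : V →L[ℝ] ℝ) : V [⋀^Fin 1]→L[ℝ] ℝ :=
  ContinuousAlternatingMap.ofSubsingleton ℝ V ℝ 0 α

/-- The `2`-form `(X, Y) ↦ b X Y` of a bilinear form `b` with `b X X = 0`. -/
def twoForm (b : V →L[ℝ] V →L[ℝ] ℝ) (hc : Continuous fun p : V × V => b p.1 p.2)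
    (hb : ∀ v, b v v = 0) : V [⋀^Fin 2]→L[ℝ] ℝ where
  toFun v := b (v 0) (v 1)
  map_update_add' := by
    intro _ v i x y
    fin_cases i <;> simp [Function.update]
  map_update_smul' := by
    intro _ v i c x
    fin_cases i <;> simp [Function.update]
  map_eq_zero_of_eq' := by
    intro v i j h hij
    fin_cases i <;> fin_cases j <;> simp_all
  cont := by
    have h : Continuous fun v : Fin 2 → V => (v 0, v 1) :=
      (continuous_apply 0).prodMk (continuous_apply 1)
    exact hc.comp h

end Forms

section Manifold

variable {E : Type*} [NormedAddCommGroup E] [NormedSpace ℝ E]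
  {H : Type*} [TopologicalSpace H] (I : ModelWithCorners ℝ E H)
  {M : Type*} [TopologicalSpace M] [ChartedSpace H M]

/-- Differential `k`-forms on `M` (smoothness is not part of the type). -/
abbrev DiffForm (M : Type*) [TopologicalSpace M] [ChartedSpace H M] (k : ℕ) :=
  Π x : M, TangentSpace I x [⋀^Fin k]→L[ℝ] ℝ

variable {I}

/-- The exterior derivative of a form on a manifold, computed at `x` by pulling the form back to
the model space along the inverse of the preferred chart at `x`. -/
def extD {k : ℕ} (α : DiffForm I M k) : DiffForm I M (k + 1) := fun x =>
  (extDerivWithin (fun y : E =>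
      (α ((extChartAt I x).symm y)).compContinuousLinearMap
        (mfderivWithin 𝓘(ℝ, E) I (extChartAt I x).symm (range I) y))
    (range I) (extChartAt I x x)).compContinuousLinearMap (mfderiv I 𝓘(ℝ, E) (extChartAt I x) x)

variable (I) in
/-- Smooth Riemannian metrics on `M`. -/
abbrev RiemMetric (M : Type*) [TopologicalSpace M] [ChartedSpace H M] [IsManifold I ∞ M] :=
  ContMDiffRiemannianMetric I ∞ E (fun x : M => TangentSpace I x)

theorem continuous_bilin {x : M} (b : TangentSpace I x →L[ℝ] TangentSpace I x →L[ℝ] ℝ) :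
    Continuous fun p : TangentSpace I x × TangentSpace I x => b p.1 p.2 := by
  let b' : E →L[ℝ] E →L[ℝ] ℝ := b
  exact (b'.continuous.comp continuous_fst).clm_apply continuous_snd


variable [IsManifold I ∞ M]

variable (I M) in
/-- An almost contact metric structure `(g, ξ, η, φ)` with `η = g(ξ, ·)`. -/
structure AlmostContactMetric where
  /-- the Riemannian metric -/
  g : RiemMetric I M
  /-- the Reeb vector field -/
  ξ : Π x : M, TangentSpace I x
  /-- the bundle endomorphism -/
  φ : Π x : M, TangentSpace I x →L[ℝ] TangentSpace I x
  smooth_ξ : ContMDiff I I.tangent ∞ (fun x => (⟨x, ξ x⟩ : TangentBundle I M))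
  smooth_φ : ContMDiff I (I.prod 𝓘(ℝ, E →L[ℝ] E)) ∞
    (fun x => TotalSpace.mk' (E →L[ℝ] E) (E := fun y : M => TangentSpace I y →L[ℝ] TangentSpace I y)
      x (φ x))
  unit_ξ : ∀ x, g.inner x (ξ x) (ξ x) = 1
  φ_ξ : ∀ x, φ x (ξ x) = 0
  φ_φ : ∀ x X, φ x (φ x X) = -X + g.inner x (ξ x) X • ξ x
  compat : ∀ x X Y, g.inner x (φ x X) (φ x Y)
    = g.inner x X Y - g.inner x (ξ x) X * g.inner x (ξ x) Y

variable (I M) in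
/-- An almost Hermitian structure `(g, J)`. -/
structure AlmostHermitian where
  /-- the Riemannian metric -/
  g : RiemMetric I M
  /-- the almost complex structure -/
  J : Π x : M, TangentSpace I x →L[ℝ] TangentSpace I x
  smooth_J : ContMDiff I (I.prod 𝓘(ℝ, E →L[ℝ] E)) ∞
    (fun x => TotalSpace.mk' (E →L[ℝ] E) (E := fun y : M => TangentSpace I y →L[ℝ] TangentSpace I y)
      x (J x))
  J_J : ∀ x X, J x (J x X) = -X
  compat : ∀ x X Y, g.inner x (J x X) (J x Y) = g.inner x X Y

namespace AlmostContactMetric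

variable (S : AlmostContactMetric I M)

/-- The dual `1`-form `η = g(ξ, ·)`. -/
def η (x : M) : TangentSpace I x →L[ℝ] ℝ := S.g.inner x (S.ξ x)

theorem η_ξ (x : M) : S.η x (S.ξ x) = 1 := S.unit_ξ x

theorem η_φ (x : M) (X : TangentSpace I x) : S.η x (S.φ x X) = 0 := by
  have h1 := S.φ_φ x (S.φ x X)
  rw [S.φ_φ x X, map_add, map_neg, map_smul, S.φ_ξ, smul_zero, add_zero, left_eq_add] at h1
  have h2 := congrArg (S.η x) h1
  rw [map_smul, S.η_ξ, map_zero, smul_eq_mul, mul_one] at h2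
  exact h2

theorem inner_φ_self (x : M) (X : TangentSpace I x) : S.g.inner x (S.φ x X) X = 0 := by
  have h1 := S.compat x (S.φ x X) X
  have h2 : S.g.inner x (S.ξ x) (S.φ x X) = 0 := S.η_φ x X
  have h3 : S.g.inner x (S.ξ x) (S.φ x X) = S.g.inner x (S.φ x X) (S.ξ x) := S.g.symm ..
  have h4 := S.g.symm x X (S.φ x X)
  rw [S.φ_φ] at h1
  simp only [map_add, map_neg, map_smul, add_apply, neg_apply, smul_apply, h2,
    zero_mul, sub_zero, smul_eq_mul, mul_zero, add_zero] at h1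
  linarith

/-- The fundamental `2`-form `F = g(φ ·, ·)`. -/
def F : DiffForm I M 2 := fun x =>
  twoForm ((S.g.inner x).comp (S.φ x)) (continuous_bilin _) (S.inner_φ_self x)

/-- The exterior derivative `dη`. -/
def dη : DiffForm I M 2 := extD fun x => oneForm (S.η x)

/-- `d^φ F = dF(φ ·, φ ·, φ ·)`. -/
def dφF : DiffForm I M 3 := fun x => (extD S.F x).compContinuousLinearMap (S.φ x)

/-- Normality (the fields `X`, `Y` only have to be differentiable at the point `x`): the Sasaki-Hatakeyama tensor
`[φX, φY] + φ²[X, Y] - φ[φX, Y] - φ[X, φY] + dη(X, Y) ξ` vanishes. -/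
def IsNormal : Prop :=
  ∀ (x : M) (X Y : Π y : M, TangentSpace I y),
    MDifferentiableAt I I.tangent (fun y => (⟨y, X y⟩ : TangentBundle I M)) x →
    MDifferentiableAt I I.tangent (fun y => (⟨y, Y y⟩ : TangentBundle I M)) x →
    VectorField.mlieBracket I (fun y => S.φ y (X y)) (fun y => S.φ y (Y y)) x
      + S.φ x (S.φ x (VectorField.mlieBracket I X Y x))
      - S.φ x (VectorField.mlieBracket I (fun y => S.φ y (X y)) Y x)
      - S.φ x (VectorField.mlieBracket I X (fun y => S.φ y (Y y)) x)
      + S.dη x ![X x, Y x] • S.ξ x = 0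

/-- `ξ` is a Killing vector field, `L_ξ g = 0`. -/
def IsKilling : Prop :=
  ∀ (x : M) (X Y : Π y : M, TangentSpace I y),
    MDifferentiableAt I I.tangent (fun y => (⟨y, X y⟩ : TangentBundle I M)) x →
    MDifferentiableAt I I.tangent (fun y => (⟨y, Y y⟩ : TangentBundle I M)) x →
    mvfderiv I (fun y => S.g.inner y (X y) (Y y)) x (S.ξ x)
      = S.g.inner x (VectorField.mlieBracket I S.ξ X x) (Y x)
        + S.g.inner x (X x) (VectorField.mlieBracket I S.ξ Y x)

/-- Sasaki with torsion: a normal almost contact metric structure with Killing Reeb field. -/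
def IsST : Prop := S.IsNormal ∧ S.IsKilling

/-- Sasaki: a normal almost contact metric structure with `dη = 2F`. -/
def IsSasaki : Prop := S.IsNormal ∧ ∀ x, S.dη x = (2 : ℝ) • S.F x

end AlmostContactMetric

namespace AlmostHermitian

variable (A : AlmostHermitian I M)

theorem inner_J_self (x : M) (X : TangentSpace I x) : A.g.inner x (A.J x X) X = 0 := by
  have h1 := A.compat x (A.J x X) X
  have h2 := A.g.symm x X (A.J x X)
  rw [A.J_J, map_neg, neg_apply] at h1
  linarith

/-- The fundamental `2`-form `g(J ·, ·)`. -/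
def fundForm : DiffForm I M 2 := fun x =>
  twoForm ((A.g.inner x).comp (A.J x)) (continuous_bilin _) (A.inner_J_self x)

/-- Integrability of `J`: the Nijenhuis tensor vanishes. -/
def IsIntegrable : Prop :=
  ∀ (x : M) (X Y : Π y : M, TangentSpace I y),
    MDifferentiableAt I I.tangent (fun y => (⟨y, X y⟩ : TangentBundle I M)) x →
    MDifferentiableAt I I.tangent (fun y => (⟨y, Y y⟩ : TangentBundle I M)) x →
    VectorField.mlieBracket I (fun y => A.J y (X y)) (fun y => A.J y (Y y)) x
      - VectorField.mlieBracket I X Y x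
      - A.J x (VectorField.mlieBracket I (fun y => A.J y (X y)) Y x)
      - A.J x (VectorField.mlieBracket I X (fun y => A.J y (Y y)) x) = 0

/-- `D` is a smooth connection with `Dg = 0`, `DJ = 0` whose torsion tensor `T` is the `3`-form
`c`, that is, `g(T(X, Y), Z) = c(X, Y, Z)` where `T(X, Y) = D_X Y - D_Y X - [X, Y]`. As `Dg = 0`,
this is the same as `g(D_X Y - D^LC_X Y, Z) = c(X, Y, Z) / 2`. In Lean `D Y x X` is `D_X Y` at `x`. -/
structure IsKTConnection [FiniteDimensional ℝ E]
    (D : CovariantDerivative I E (fun x : M => TangentSpace I x)) (c : DiffForm I M 3) : Prop where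
  smooth : CovariantDerivative.ContMDiffCovariantDerivative D ∞
  metric : ∀ (x : M) (Y Z : Π y : M, TangentSpace I y) (X : TangentSpace I x),
    MDifferentiableAt I I.tangent (fun y => (⟨y, Y y⟩ : TangentBundle I M)) x →
    MDifferentiableAt I I.tangent (fun y => (⟨y, Z y⟩ : TangentBundle I M)) x →
    mvfderiv I (fun y => A.g.inner y (Y y) (Z y)) x X
      = A.g.inner x (D Y x X) (Z x) + A.g.inner x (Y x) (D Z x X)
  parallel : ∀ (x : M) (Y : Π y : M, TangentSpace I y) (X : TangentSpace I x),
    MDifferentiableAt I I.tangent (fun y => (⟨y, Y y⟩ : TangentBundle I M)) x →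
    D (fun y => A.J y (Y y)) x X = A.J x (D Y x X)
  torsion : ∀ (x : M) (X Y Z : TangentSpace I x),
    A.g.inner x (D.torsion x X Y) Z = c x ![X, Y, Z]

variable [FiniteDimensional ℝ E]

/-- `(g, J)` is a Kähler with torsion structure with torsion `3`-form `c`: it is Hermitian and
carries a Hermitian connection with skew-symmetric torsion `c`. -/
def IsKTWithTorsion (c : DiffForm I M 3) : Prop :=
  A.IsIntegrable ∧ ∃ D : CovariantDerivative I E (fun x : M => TangentSpace I x),
    A.IsKTConnection D c

/-- Strong Kähler with torsion: the torsion `3`-form is closed. -/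
def IsSKT : Prop := ∃ c : DiffForm I M 3, A.IsKTWithTorsion c ∧ ∀ x, extD c x = 0

end AlmostHermitian

end Manifold

section Cone

/-- The positive half-line as an open submanifold of `ℝ`. -/
def PosReal : TopologicalSpace.Opens ℝ := ⟨Ioi 0, isOpen_Ioi⟩

/-- The cone `ℝ₊ × N`, with its product manifold structure. -/
abbrev Cone (N : Type*) := PosReal × N

variable {E : Type*} [NormedAddCommGroup E] [NormedSpace ℝ E]
  {H : Type*} [TopologicalSpace H] {I : ModelWithCorners ℝ E H}
  {N : Type*} [TopologicalSpace N] [ChartedSpace H N]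

variable (I) in
/-- The radial `1`-form `dr`, the differential of the coordinate `r`. -/
def dr (x : Cone N) : TangentSpace (𝓘(ℝ, ℝ).prod I) x →L[ℝ] ℝ :=
  mvfderiv (𝓘(ℝ, ℝ).prod I) (fun y : Cone N => (y.1 : ℝ)) x

variable (I) in
/-- The differential of the projection of the cone onto its base. -/
def dπ (x : Cone N) : TangentSpace (𝓘(ℝ, ℝ).prod I) x →L[ℝ] TangentSpace I x.2 :=
  mfderiv (𝓘(ℝ, ℝ).prod I) I (fun y : Cone N => y.2) x

variable (I) in
/-- The tangent vector `a ∂/∂r + v` at a point of the cone, under the identification of the tangent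
space of a product with the product of the tangent spaces. -/
def coneVec (x : Cone N) : (ℝ × TangentSpace I x.2) →L[ℝ] TangentSpace (𝓘(ℝ, ℝ).prod I) x :=
  ContinuousLinearMap.id ℝ (ℝ × TangentSpace I x.2)

theorem hasMFDerivAt_val (r : PosReal) :
    HasMFDerivAt 𝓘(ℝ, ℝ) 𝓘(ℝ, ℝ) (fun s : PosReal => (s : ℝ)) r
      (ContinuousLinearMap.id ℝ (TangentSpace 𝓘(ℝ, ℝ) r)) := by
  refine ⟨continuous_subtype_val.continuousAt, ?_⟩
  have h : writtenInExtChartAt 𝓘(ℝ, ℝ) 𝓘(ℝ, ℝ) r (fun s : PosReal => (s : ℝ))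
      =ᶠ[𝓝 (extChartAt 𝓘(ℝ, ℝ) r r)] id := by
    have ht : (extChartAt 𝓘(ℝ, ℝ) r).target ∈ 𝓝 (extChartAt 𝓘(ℝ, ℝ) r r) :=
      extChartAt_target_mem_nhds r
    filter_upwards [ht] with y hy
    exact (extChartAt 𝓘(ℝ, ℝ) r).right_inv hy
  simp only [modelWithCornersSelf_coe, range_id]
  exact ((hasFDerivAt_id _).congr_of_eventuallyEq h).hasFDerivWithinAt

theorem dr_coneVec (x : Cone N) (a : ℝ) (v : TangentSpace I x.2) :
    dr I x (coneVec I x (a, v)) = a := by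
  have h : HasMFDerivAt (𝓘(ℝ, ℝ).prod I) 𝓘(ℝ, ℝ) (fun y : Cone N => (y.1 : ℝ)) x _ :=
    HasMFDerivAt.comp x (hasMFDerivAt_val x.1) (hasMFDerivAt_fst (x := x))
  simp only [dr, mvfderiv, h.mfderiv]
  rfl

theorem dπ_coneVec (x : Cone N) (a : ℝ) (v : TangentSpace I x.2) :
    dπ I x (coneVec I x (a, v)) = v := by
  simp only [dπ]
  erw [mfderiv_snd]
  rfl

theorem coneVec_dr_dπ (x : Cone N) (X : TangentSpace (𝓘(ℝ, ℝ).prod I) x) :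
    coneVec I x (dr I x X, dπ I x X) = X := by
  let Y : ℝ × TangentSpace I x.2 := X
  have h1 : dr I x X = Y.1 := dr_coneVec x Y.1 Y.2
  have h2 : dπ I x X = Y.2 := dπ_coneVec x Y.1 Y.2
  rw [h1, h2]
  rfl

variable (I) in
/-- The bilinear form `dr ⊗ dr + r² b` at a point `(r, p)` of the cone, for `b` on `T_p N`. -/
def coneInner (x : Cone N) (b : TangentSpace I x.2 →L[ℝ] TangentSpace I x.2 →L[ℝ] ℝ) :
    TangentSpace (𝓘(ℝ, ℝ).prod I) x →L[ℝ] TangentSpace (𝓘(ℝ, ℝ).prod I) x →L[ℝ] ℝ :=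
  (dr I x).smulRight (dr I x) +
    (x.1 : ℝ) ^ 2 • (ContinuousLinearMap.precomp ℝ (dπ I x)).comp (b.comp (dπ I x))

theorem coneInner_apply (x : Cone N) (b : TangentSpace I x.2 →L[ℝ] TangentSpace I x.2 →L[ℝ] ℝ)
    (X Y : TangentSpace (𝓘(ℝ, ℝ).prod I) x) :
    coneInner I x b X Y = dr I x X * dr I x Y + (x.1 : ℝ) ^ 2 * b (dπ I x X) (dπ I x Y) := rfl

section Smooth

theorem contMDiffAt_hom {B : Type*} [TopologicalSpace B] [ChartedSpace H B]
    {F₁ F₂ : Type*} [NormedAddCommGroup F₁] [NormedSpace ℝ F₁] [FiniteDimensional ℝ F₁]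
    [NormedAddCommGroup F₂] [NormedSpace ℝ F₂] {V₁ V₂ : B → Type*}
    [TopologicalSpace (TotalSpace F₁ V₁)] [∀ x, AddCommGroup (V₁ x)] [∀ x, Module ℝ (V₁ x)]
    [∀ x, TopologicalSpace (V₁ x)] [FiberBundle F₁ V₁] [VectorBundle ℝ F₁ V₁]
    [ContMDiffVectorBundle ∞ F₁ V₁ I]
    [TopologicalSpace (TotalSpace F₂ V₂)] [∀ x, AddCommGroup (V₂ x)] [∀ x, Module ℝ (V₂ x)]
    [∀ x, TopologicalSpace (V₂ x)] [FiberBundle F₂ V₂] [VectorBundle ℝ F₂ V₂]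
    [∀ x, IsTopologicalAddGroup (V₂ x)] [∀ x, ContinuousSMul ℝ (V₂ x)]
    (A : Π x, V₁ x →L[ℝ] V₂ x) (x₀ : B)
    (h : ∀ X : Π x, V₁ x, ContMDiffAt I (I.prod 𝓘(ℝ, F₁)) ∞ (fun x => TotalSpace.mk' F₁ x (X x)) x₀ →
      ContMDiffAt I (I.prod 𝓘(ℝ, F₂)) ∞ (fun x => TotalSpace.mk' F₂ x (A x (X x))) x₀) :
    ContMDiffAt I (I.prod 𝓘(ℝ, F₁ →L[ℝ] F₂)) ∞
      (fun x => TotalSpace.mk' (F₁ →L[ℝ] F₂) (E := fun y => V₁ y →L[ℝ] V₂ y) x (A x)) x₀ := by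
  rw [contMDiffAt_hom_bundle]
  refine ⟨contMDiffAt_id, ?_⟩
  set b := Module.finBasis ℝ F₁
  have key : ∀ v : F₁, ContMDiffAt I 𝓘(ℝ, F₂) ∞
      (fun x => ContinuousLinearMap.inCoordinates F₁ V₁ F₂ V₂ x₀ x x₀ x (A x) v) x₀ := by
    intro v
    have h0 : x₀ ∈ (trivializationAt F₁ V₁ x₀).baseSet := FiberBundle.mem_baseSet_trivializationAt' x₀
    have h0' : x₀ ∈ (trivializationAt F₂ V₂ x₀).baseSet := FiberBundle.mem_baseSet_trivializationAt' x₀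
    have h1 := h _ (FiberBundle.contMDiffAt_extend I F₁ ((trivializationAt F₁ V₁ x₀).symm x₀ v))
    rw [contMDiffAt_totalSpace] at h1
    refine h1.2.congr_of_eventuallyEq ?_
    filter_upwards [(trivializationAt F₁ V₁ x₀).open_baseSet.mem_nhds h0,
      (trivializationAt F₂ V₂ x₀).open_baseSet.mem_nhds h0'] with x hx hx'
    rw [ContinuousLinearMap.inCoordinates_eq hx hx']
    simp [FiberBundle.extend, h0]
  have h2 : (fun x => ContinuousLinearMap.inCoordinates F₁ V₁ F₂ V₂ x₀ x x₀ x (A x)) =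
      fun x => ∑ i, ((b.coord i).toContinuousLinearMap).smulRight
        (ContinuousLinearMap.inCoordinates F₁ V₁ F₂ V₂ x₀ x x₀ x (A x) (b i)) := by
    ext x v
    conv_lhs => rw [← b.sum_repr v, map_sum]
    simp
  simp only [TotalSpace.mk']
  rw [h2]
  refine contMDiffAt_finsetSum fun i _ => ?_
  exact ((ContinuousLinearMap.smulRightL ℝ F₁ F₂
    ((b.coord i).toContinuousLinearMap)).contMDiff.contMDiffAt).comp x₀ (key (b i))


variable [IsManifold I ∞ N]

theorem contMDiffAt_dr (x₀ : Cone N) (X : Π x : Cone N, TangentSpace (𝓘(ℝ, ℝ).prod I) x)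
    (hX : ContMDiffAt (𝓘(ℝ, ℝ).prod I) (𝓘(ℝ, ℝ).prod I).tangent ∞
      (fun x => (⟨x, X x⟩ : TangentBundle (𝓘(ℝ, ℝ).prod I) (Cone N))) x₀) :
    ContMDiffAt (𝓘(ℝ, ℝ).prod I) 𝓘(ℝ, ℝ) ∞ (fun x => dr I x (X x)) x₀ := by
  have h1 : ContMDiff (𝓘(ℝ, ℝ).prod I) 𝓘(ℝ, ℝ) ∞ (fun y : Cone N => (y.1 : ℝ)) :=
    contMDiff_subtype_val.comp contMDiff_fst
  have h2 := ((h1.contMDiff_tangentMap (m := ∞) le_rfl).contMDiffAt).comp x₀ hX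
  exact ((contMDiff_snd_tangentBundle_modelSpace ℝ 𝓘(ℝ, ℝ)).contMDiffAt).comp x₀ h2

theorem contMDiffAt_dπ (x₀ : Cone N) (X : Π x : Cone N, TangentSpace (𝓘(ℝ, ℝ).prod I) x)
    (hX : ContMDiffAt (𝓘(ℝ, ℝ).prod I) (𝓘(ℝ, ℝ).prod I).tangent ∞
      (fun x => (⟨x, X x⟩ : TangentBundle (𝓘(ℝ, ℝ).prod I) (Cone N))) x₀) :
    ContMDiffAt (𝓘(ℝ, ℝ).prod I) I.tangent ∞
      (fun x => (⟨x.2, dπ I x (X x)⟩ : TangentBundle I N)) x₀ := by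
  have h1 : ContMDiff (𝓘(ℝ, ℝ).prod I) I ∞ (fun y : Cone N => y.2) := contMDiff_snd
  exact ((h1.contMDiff_tangentMap (m := ∞) le_rfl).contMDiffAt).comp x₀ hX

theorem trivializationAt_posReal (r s : PosReal) (a : TangentSpace 𝓘(ℝ, ℝ) s) :
    (trivializationAt ℝ (TangentSpace 𝓘(ℝ, ℝ)) r (⟨s, a⟩ : TangentBundle 𝓘(ℝ, ℝ) PosReal)).2
      = a := by
  rw [TangentBundle.trivializationAt_apply]
  have hc : chartAt ℝ r = chartAt ℝ s := rfl
  have h := tangentCoordChange_self (I := 𝓘(ℝ, ℝ)) (x := s) (z := s) (v := a)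
    (mem_extChartAt_source s)
  rw [tangentCoordChange_def] at h
  rw [hc]
  exact h

theorem contMDiffAt_coneVec (x₀ : Cone N) (a : Cone N → ℝ)
    (v : Π x : Cone N, TangentSpace I x.2) (ha : ContMDiffAt (𝓘(ℝ, ℝ).prod I) 𝓘(ℝ, ℝ) ∞ a x₀)
    (hv : ContMDiffAt (𝓘(ℝ, ℝ).prod I) I.tangent ∞
      (fun x => (⟨x.2, v x⟩ : TangentBundle I N)) x₀) :
    ContMDiffAt (𝓘(ℝ, ℝ).prod I) (𝓘(ℝ, ℝ).prod I).tangent ∞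
      (fun x => (⟨x, coneVec I x (a x, v x)⟩ : TangentBundle (𝓘(ℝ, ℝ).prod I) (Cone N))) x₀ := by
  have h1 : ContMDiffAt (𝓘(ℝ, ℝ).prod I) 𝓘(ℝ, ℝ).tangent ∞
      (fun x => (⟨x.1, a x⟩ : TangentBundle 𝓘(ℝ, ℝ) PosReal)) x₀ := by
    rw [contMDiffAt_totalSpace]
    refine ⟨contMDiffAt_fst, ?_⟩
    refine ha.congr_of_eventuallyEq ?_
    filter_upwards with x
    exact trivializationAt_posReal x₀.1 x.1 (a x)
  exact ((contMDiff_equivTangentBundleProd_symm (I := 𝓘(ℝ, ℝ)) (M := PosReal) (I' := I)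
    (M' := N)).contMDiffAt).comp x₀ (h1.prodMk hv)

theorem contMDiff_coneInner [FiniteDimensional ℝ E] (g : RiemMetric I N) :
    ContMDiff (𝓘(ℝ, ℝ).prod I) ((𝓘(ℝ, ℝ).prod I).prod 𝓘(ℝ, (ℝ × E) →L[ℝ] (ℝ × E) →L[ℝ] ℝ)) ∞
      (fun x : Cone N => TotalSpace.mk' ((ℝ × E) →L[ℝ] (ℝ × E) →L[ℝ] ℝ)
        (E := fun x : Cone N => TangentSpace (𝓘(ℝ, ℝ).prod I) x →L[ℝ]
          TangentSpace (𝓘(ℝ, ℝ).prod I) x →L[ℝ] ℝ)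
        x (coneInner I x (g.inner x.2))) := by
  intro x₀
  refine contMDiffAt_hom (F₁ := ℝ × E) (F₂ := (ℝ × E) →L[ℝ] ℝ) _ x₀ fun X hX => ?_
  refine contMDiffAt_hom (F₁ := ℝ × E) (F₂ := ℝ) (V₂ := Bundle.Trivial (Cone N) ℝ) _ x₀ fun Y hY => ?_
  rw [contMDiffAt_totalSpace]
  refine ⟨contMDiffAt_id, ?_⟩
  have hr : ContMDiffAt (𝓘(ℝ, ℝ).prod I) 𝓘(ℝ, ℝ) ∞ (fun y : Cone N => (y.1 : ℝ)) x₀ :=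
    (contMDiff_subtype_val.comp contMDiff_fst).contMDiffAt
  have hg : ContMDiffAt (𝓘(ℝ, ℝ).prod I) 𝓘(ℝ, ℝ) ∞
      (fun x : Cone N => g.inner x.2 (dπ I x (X x)) (dπ I x (Y x))) x₀ := by
    have h3 := ContMDiffAt.clm_bundle_apply₂ (F₁ := E) (F₂ := E) (F₃ := ℝ)
      (E₃ := Bundle.Trivial N ℝ) (b := fun x : Cone N => x.2)
      ((g.contMDiff.contMDiffAt).comp x₀ contMDiffAt_snd) (contMDiffAt_dπ x₀ X hX)
      (contMDiffAt_dπ x₀ Y hY)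
    exact (contMDiffAt_totalSpace.1 h3).2
  exact ((contMDiffAt_dr x₀ X hX).mul (contMDiffAt_dr x₀ Y hY)).add ((hr.pow 2).mul hg)

end Smooth

variable [IsManifold I ∞ N]

theorem coneInner_pos (g : RiemMetric I N) (x : Cone N)
    (X : TangentSpace (𝓘(ℝ, ℝ).prod I) x) (hX : X ≠ 0) : 0 < coneInner I x (g.inner x.2) X X := by
  have hr : (0 : ℝ) < (x.1 : ℝ) ^ 2 := pow_pos x.1.2 2
  rw [coneInner_apply]
  by_cases h : dπ I x X = 0
  · have h' : dr I x X ≠ 0 := by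
      intro h'
      apply hX
      rw [← coneVec_dr_dπ x X, h, h', Prod.mk_zero_zero, map_zero]
    rw [h, map_zero, mul_zero, add_zero]
    exact mul_self_pos.2 h'
  · have := g.pos x.2 _ h
    nlinarith [mul_self_nonneg (dr I x X), mul_pos hr this]

theorem inner_self_nonneg (g : RiemMetric I N) (p : N) (v : TangentSpace I p) :
    0 ≤ g.inner p v v := by
  by_cases hv : v = 0
  · rw [hv, map_zero]
  · exact (g.pos p v hv).le

section Bounded

open scoped Pointwise

theorem coneInner_bounded (g : RiemMetric I N) (x : Cone N) :
    Bornology.IsVonNBounded ℝ {X : TangentSpace (𝓘(ℝ, ℝ).prod I) x |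
      coneInner I x (g.inner x.2) X X < 1} := by
  have hr : (0 : ℝ) < x.1 := x.1.2
  let S : Set E := {v : TangentSpace I x.2 | g.inner x.2 v v < 1}
  have hS : Bornology.IsBounded S := (NormedSpace.isVonNBounded_iff ℝ).1 (g.isVonNBounded x.2)
  let T : Set (ℝ × E) := {X : TangentSpace (𝓘(ℝ, ℝ).prod I) x |
    coneInner I x (g.inner x.2) X X < 1}
  have key : ∀ (a : ℝ) (v : TangentSpace I x.2),
      coneInner I x (g.inner x.2) (coneVec I x (a, v)) (coneVec I x (a, v)) < 1 →
      a ∈ Icc (-1 : ℝ) 1 ∧ g.inner x.2 ((x.1 : ℝ) • v) ((x.1 : ℝ) • v) < 1 := by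
    intro a v h
    rw [coneInner_apply, dr_coneVec, dπ_coneVec] at h
    have h3 := mul_nonneg (sq_nonneg (x.1 : ℝ)) (inner_self_nonneg g x.2 v)
    rw [map_smul, map_smul, smul_apply, smul_eq_mul, smul_eq_mul]
    refine ⟨⟨?_, ?_⟩, ?_⟩ <;> nlinarith [mul_self_nonneg a]
  have hT : T ⊆ Icc (-1 : ℝ) 1 ×ˢ ((x.1 : ℝ)⁻¹ • S) := by
    rintro ⟨a, v⟩ hX
    exact ⟨(key a v hX).1, (mem_inv_smul_set_iff₀ hr.ne' S v).2 (key a v hX).2⟩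
  have hT' : Bornology.IsBounded T :=
    ((Metric.isBounded_Icc _ _).prod (hS.smul₀ _)).subset hT
  exact (NormedSpace.isVonNBounded_iff ℝ (s := T)).2 hT'

end Bounded

/-- The cone metric `dr² + r² g`. -/
def coneMetric [FiniteDimensional ℝ E] (g : RiemMetric I N) : RiemMetric (𝓘(ℝ, ℝ).prod I) (Cone N) where
  inner x := coneInner I x (g.inner x.2)
  symm x X Y := by
    rw [coneInner_apply, coneInner_apply, g.symm, mul_comm (dr I x X)]
  pos := coneInner_pos g
  isVonNBounded := coneInner_bounded g
  contMDiff := contMDiff_coneInner g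

namespace AlmostContactMetric

variable (S : AlmostContactMetric I N)

/-- The almost complex structure of the cone, determined by
`J (∂/∂r) = ξ / r`, `J ξ = - r ∂/∂r` and `J = φ` on `ker η`. -/
def coneJ (x : Cone N) :
    TangentSpace (𝓘(ℝ, ℝ).prod I) x →L[ℝ] TangentSpace (𝓘(ℝ, ℝ).prod I) x :=
  (coneVec I x).comp
    ((-(x.1 : ℝ) • (S.η x.2).comp (dπ I x)).prod
      ((S.φ x.2).comp (dπ I x) + (x.1 : ℝ)⁻¹ • (dr I x).smulRight (S.ξ x.2)))

theorem coneJ_apply (x : Cone N) (X : TangentSpace (𝓘(ℝ, ℝ).prod I) x) :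
    S.coneJ x X = coneVec I x (-(x.1 : ℝ) * S.η x.2 (dπ I x X),
      S.φ x.2 (dπ I x X) + ((x.1 : ℝ)⁻¹ * dr I x X) • S.ξ x.2) := by
  rw [mul_smul]
  rfl

/-- The almost Hermitian structure of the cone over an almost contact metric manifold. -/
def cone [FiniteDimensional ℝ E] : AlmostHermitian (𝓘(ℝ, ℝ).prod I) (Cone N) where
  g := coneMetric S.g
  J := S.coneJ
  smooth_J := by
    intro x₀
    refine contMDiffAt_hom (F₁ := ℝ × E) (F₂ := ℝ × E) _ x₀ fun X hX => ?_
    have hr : ContMDiffAt (𝓘(ℝ, ℝ).prod I) 𝓘(ℝ, ℝ) ∞ (fun y : Cone N => (y.1 : ℝ)) x₀ :=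
      (contMDiff_subtype_val.comp contMDiff_fst).contMDiffAt
    have hr0 : (x₀.1 : ℝ) ≠ 0 := (show (0 : ℝ) < x₀.1 from x₀.1.2).ne'
    have hξ : ContMDiffAt (𝓘(ℝ, ℝ).prod I) I.tangent ∞
        (fun x : Cone N => (⟨x.2, S.ξ x.2⟩ : TangentBundle I N)) x₀ :=
      S.smooth_ξ.contMDiffAt.comp x₀ contMDiffAt_snd
    have hπ := contMDiffAt_dπ x₀ X hX
    have hη : ContMDiffAt (𝓘(ℝ, ℝ).prod I) 𝓘(ℝ, ℝ) ∞
        (fun x : Cone N => S.η x.2 (dπ I x (X x))) x₀ := by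
      have h3 := ContMDiffAt.clm_bundle_apply₂ (F₁ := E) (F₂ := E) (F₃ := ℝ)
        (E₃ := Bundle.Trivial N ℝ) (b := fun x : Cone N => x.2)
        ((S.g.contMDiff.contMDiffAt).comp x₀ contMDiffAt_snd) hξ hπ
      exact (contMDiffAt_totalSpace.1 h3).2
    have hφ : ContMDiffAt (𝓘(ℝ, ℝ).prod I) I.tangent ∞
        (fun x : Cone N => (⟨x.2, S.φ x.2 (dπ I x (X x))⟩ : TangentBundle I N)) x₀ :=
      ContMDiffAt.clm_bundle_apply (F₁ := E) (F₂ := E) (b := fun x : Cone N => x.2)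
        (S.smooth_φ.contMDiffAt.comp x₀ contMDiffAt_snd) hπ
    have hc : ContMDiffAt (𝓘(ℝ, ℝ).prod I) 𝓘(ℝ, ℝ) ∞
        (fun x : Cone N => (x.1 : ℝ)⁻¹ * dr I x (X x)) x₀ :=
      (hr.inv₀ hr0).mul (contMDiffAt_dr x₀ X hX)
    have h1 := contMDiffAt_coneVec x₀ _ _ (hr.neg.mul hη) hφ
    have h2 := contMDiffAt_coneVec x₀ (fun _ => 0) _ contMDiffAt_const hξ
    have h3 := h1.add_section (hc.smul_section h2)
    refine h3.congr_of_eventuallyEq ?_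
    filter_upwards with x
    rw [coneJ_apply]
    simp only [Pi.add_apply, Pi.smul_apply', TotalSpace.mk']
    rw [← map_smul, ← map_add]
    simp
  J_J x X := by
    have hr0 : (x.1 : ℝ) ≠ 0 := (show (0 : ℝ) < x.1 from x.1.2).ne'
    have h1 : dπ I x (S.coneJ x X) = S.φ x.2 (dπ I x X) + ((x.1 : ℝ)⁻¹ * dr I x X) • S.ξ x.2 := by
      rw [coneJ_apply, dπ_coneVec]
    have h2 : dr I x (S.coneJ x X) = -(x.1 : ℝ) * S.η x.2 (dπ I x X) := by
      rw [coneJ_apply, dr_coneVec]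
    rw [coneJ_apply, h1, h2, map_add, map_smul, S.η_φ, S.η_ξ, map_add, S.φ_φ, map_smul, S.φ_ξ]
    have h3 : S.g.inner x.2 (S.ξ x.2) (dπ I x X) = S.η x.2 (dπ I x X) := rfl
    conv_rhs => rw [← coneVec_dr_dπ x X, ← map_neg]
    rw [h3]
    congr 1
    ext
    · simp only [Prod.fst_neg, smul_eq_mul]
      field_simp
      ring
    · simp only [Prod.snd_neg, smul_zero, add_zero]
      rw [add_assoc, ← add_smul]
      field_simp
      simp
  compat x X Y := by
    have hr0 : (x.1 : ℝ) ≠ 0 := (show (0 : ℝ) < x.1 from x.1.2).ne'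
    have h1 : ∀ X, dπ I x (S.coneJ x X) = S.φ x.2 (dπ I x X) + ((x.1 : ℝ)⁻¹ * dr I x X) • S.ξ x.2 := by
      intro X
      rw [coneJ_apply, dπ_coneVec]
    have h2 : ∀ X, dr I x (S.coneJ x X) = -(x.1 : ℝ) * S.η x.2 (dπ I x X) := by
      intro X
      rw [coneJ_apply, dr_coneVec]
    have h3 : ∀ v, S.g.inner x.2 (S.ξ x.2) v = S.η x.2 v := fun v => rfl
    have h4 : ∀ v, S.g.inner x.2 v (S.ξ x.2) = S.η x.2 v := fun v => S.g.symm ..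
    change coneInner I x _ _ _ = coneInner I x _ _ _
    rw [coneInner_apply, coneInner_apply, h1, h2, h1, h2]
    simp only [map_add, map_smul, add_apply, smul_apply, smul_eq_mul, S.compat, h3, h4, S.η_φ,
      S.η_ξ]
    field_simp
    ring

/-- The `3`-form `r² (η ∧ (dη - 2F) + d^φ F)` on the cone. -/
def coneTorsion : DiffForm (𝓘(ℝ, ℝ).prod I) (Cone N) 3 := fun x =>
  (x.1 : ℝ) ^ 2 • (wedge (S.η x.2) (S.dη x.2 - (2 : ℝ) • S.F x.2)
    + S.dφF x.2).compContinuousLinearMap (dπ I x)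

/-- The `2`-form `r dr ∧ η + r² F` on the cone. -/
def coneForm : DiffForm (𝓘(ℝ, ℝ).prod I) (Cone N) 2 := fun x =>
  (x.1 : ℝ) • wedge (dr I x) (oneForm ((S.η x.2).comp (dπ I x)))
    + (x.1 : ℝ) ^ 2 • (S.F x.2).compContinuousLinearMap (dπ I x)

end AlmostContactMetric

end Cone

end TorsionGeometry

end

open TorsionGeometry

noncomputable section

namespace TorsionGeometry

section Calculus

variable {E : Type*} [NormedAddCommGroup E] [NormedSpace ℝ E]
  {H : Type*} [TopologicalSpace H] {I : ModelWithCorners ℝ E H}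
  {M : Type*} [TopologicalSpace M] [ChartedSpace H M]

/-- The derivative of the inverse of the preferred chart at `x`. -/
def chartSymmD (I : ModelWithCorners ℝ E H) {M : Type*} [TopologicalSpace M] [ChartedSpace H M]
    (x : M) (y : E) : E →L[ℝ] TangentSpace I ((extChartAt I x).symm y) :=
  mfderivWithin 𝓘(ℝ, E) I (extChartAt I x).symm (range I) y

/-- The expression of a form in the preferred chart at `x`. -/
def chartForm {k : ℕ} (α : DiffForm I M k) (x : M) (y : E) : E [⋀^Fin k]→L[ℝ] ℝ :=
  (α ((extChartAt I x).symm y)).compContinuousLinearMap (chartSymmD I x y)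

/-- The expression of a vector field in the preferred chart at `x`. -/
def chartField (V : Π y : M, TangentSpace I y) (x : M) (y : E) : E :=
  VectorField.mpullbackWithin 𝓘(ℝ, E) I (extChartAt I x).symm V (range I) y

theorem field_congr (V : Π y : M, TangentSpace I y) {x y : M} (h : y = x) :
    (V y : E) = (V x : E) := by
  subst h
  rfl

theorem form_congr {k : ℕ} (α : DiffForm I M k) {x y : M} (h : y = x) (v : Fin k → E) :
    (α y : E [⋀^Fin k]→L[ℝ] ℝ) v = (α x : E [⋀^Fin k]→L[ℝ] ℝ) v := by
  subst h
  rfl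

theorem mvfderiv_eq {f : M → ℝ} {x : M} (hf : MDifferentiableAt I 𝓘(ℝ, ℝ) f x)
    (v : TangentSpace I x) :
    mvfderiv I f x v = fderivWithin ℝ (fun y => f ((extChartAt I x).symm y)) (range I)
      (extChartAt I x x) v := by
  rw [hf.mvfderiv]
  rfl

theorem differentiableWithinAt_comp_symm {f : M → ℝ} {x : M}
    (hf : MDifferentiableAt I 𝓘(ℝ, ℝ) f x) :
    DifferentiableWithinAt ℝ (fun y => f ((extChartAt I x).symm y)) (range I)
      (extChartAt I x x) := by
  exact ((mdifferentiableAt_iff f x).1 hf).2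

variable [IsManifold I ∞ M]

theorem isManifold_one : IsManifold I 1 M := IsManifold.of_le (n := ∞) (by norm_cast)

theorem isManifold_two : IsManifold I 2 M := IsManifold.of_le (n := ∞) (by norm_cast)

theorem extD_eq {k : ℕ} (α : DiffForm I M k) (x : M) (v : Fin (k + 1) → TangentSpace I x) :
    extD α x v = extDerivWithin (chartForm α x) (range I) (extChartAt I x x) v := by
  have := isManifold_one (I := I) (M := M)
  have h : ∀ w : TangentSpace I x, mfderiv I 𝓘(ℝ, E) (extChartAt I x) x w = w := fun w => by
    rw [mfderiv_extChartAt_self]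
    rfl
  exact congrArg (extDerivWithin (chartForm α x) (range I) (extChartAt I x x))
    (funext fun i => h (v i))

theorem chartField_self (V : Π y : M, TangentSpace I y) (x : M) :
    chartField V x (extChartAt I x x) = V x := by
  have := isManifold_one (I := I) (M := M)
  exact (mfderivWithin_extChartAt_symm_inverse_apply (I := I) (x := x)
    (V ((extChartAt I x).symm (extChartAt I x x)) : E)).trans (field_congr V (extChartAt_to_inv x))

theorem chartSymmD_chartField (V : Π y : M, TangentSpace I y) (x : M) {y : E}
    (hy : y ∈ (extChartAt I x).target) :
    chartSymmD I x y (chartField V x y)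
      = V ((extChartAt I x).symm y) := by
  have := isManifold_one (I := I) (M := M)
  exact (isInvertible_mfderivWithin_extChartAt_symm hy).self_apply_inverse _

theorem chartForm_chartField {k : ℕ} (α : DiffForm I M k) (V : Fin k → Π y : M, TangentSpace I y)
    (x : M) {y : E} (hy : y ∈ (extChartAt I x).target) :
    chartForm α x y (fun i => chartField (V i) x y)
      = α ((extChartAt I x).symm y) (fun i => V i ((extChartAt I x).symm y)) :=
  congrArg (α ((extChartAt I x).symm y)) (funext fun i => chartSymmD_chartField (V i) x hy)

theorem chartForm_self {k : ℕ} (α : DiffForm I M k) (x : M) (v : Fin k → TangentSpace I x) :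
    chartForm α x (extChartAt I x x) v = α x v := by
  have := isManifold_one (I := I) (M := M)
  have h : ∀ w : E, (chartSymmD I x (extChartAt I x x) w : E) = w := fun w => by
    rw [chartSymmD, mfderivWithin_range_extChartAt_symm]
    rfl
  exact (congrArg (α ((extChartAt I x).symm (extChartAt I x x)) : E [⋀^Fin k]→L[ℝ] ℝ)
    (funext fun i => h (v i))).trans (form_congr α (extChartAt_to_inv x) v)

theorem mlieBracket_eq (V W : Π y : M, TangentSpace I y) (x : M) :
    VectorField.mlieBracket I V W x = VectorField.lieBracketWithin ℝ (chartField V x)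
      (chartField W x) (range I) (extChartAt I x x) := by
  have := isManifold_one (I := I) (M := M)
  have h : ∀ w : E, (mfderiv I 𝓘(ℝ, E) (extChartAt I x) x : E →L[ℝ] E).inverse w = w := fun w => by
    rw [mfderiv_extChartAt_self]
    exact congrArg (fun A : E →L[ℝ] E => A w) ContinuousLinearMap.inverse_id
  rw [← VectorField.mlieBracketWithin_univ, VectorField.mlieBracketWithin_apply]
  simp only [preimage_univ, univ_inter]
  exact h _

theorem differentiableWithinAt_chartField [CompleteSpace E] {V : Π y : M, TangentSpace I y} {x : M}
    (hV : MDifferentiableAt I I.tangent (fun y => (⟨y, V y⟩ : TangentBundle I M)) x) :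
    DifferentiableWithinAt ℝ (chartField V x) (range I) (extChartAt I x x) := by
  have := isManifold_one (I := I) (M := M)
  have := isManifold_two (I := I) (M := M)
  have h := (mdifferentiableWithinAt_univ.2 hV).differentiableWithinAt_mpullbackWithin_vectorField
  simp only [preimage_univ, univ_inter] at h
  exact h

/-- A form is smooth at `x` if it takes smooth values on vector fields that are smooth at `x`. -/
def SmoothFormAt {k : ℕ} (α : DiffForm I M k) (x : M) : Prop :=
  ∀ V : Fin k → Π y : M, TangentSpace I y,
    (∀ i, ContMDiffAt I I.tangent ∞ (fun y => (⟨y, V i y⟩ : TangentBundle I M)) x) →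
    ContMDiffAt I 𝓘(ℝ, ℝ) ∞ (fun y => α y (fun i => V i y)) x

theorem eqOn_chartForm_chartField {k : ℕ} (α : DiffForm I M k)
    (V : Fin k → Π y : M, TangentSpace I y) (x : M) :
    (fun y => chartForm α x y (fun i => chartField (V i) x y)) =ᶠ[𝓝[range I] (extChartAt I x x)]
      fun y => α ((extChartAt I x).symm y) (fun i => V i ((extChartAt I x).symm y)) := by
  filter_upwards [extChartAt_target_mem_nhdsWithin x] with y hy
  exact chartForm_chartField α V x hy

theorem contMDiffAt_mvfderiv {f : M → ℝ} {V : Π y : M, TangentSpace I y} {x : M}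
    (hf : ContMDiffAt I 𝓘(ℝ, ℝ) ∞ f x)
    (hV : ContMDiffAt I I.tangent ∞ (fun y => (⟨y, V y⟩ : TangentBundle I M)) x) :
    ContMDiffAt I 𝓘(ℝ, ℝ) ∞ (fun y => mvfderiv I f y (V y)) x := by
  have := isManifold_one (I := I) (M := M)
  have h := ContMDiffAt.clm_apply_of_inCoordinates (b₁ := fun y => y) (b₂ := f)
    (ContMDiffAt.mfderiv_const (m := ∞) hf (by simp)) hV hf
  exact ((contMDiff_snd_tangentBundle_modelSpace ℝ 𝓘(ℝ, ℝ)).contMDiffAt).comp x h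

theorem eventually_mdifferentiableAt_section {V : Π y : M, TangentSpace I y} {x : M}
    (hV : ContMDiffAt I I.tangent ∞ (fun y => (⟨y, V y⟩ : TangentBundle I M)) x) :
    ∀ᶠ z in 𝓝 x, MDifferentiableAt I I.tangent (fun y => (⟨y, V y⟩ : TangentBundle I M)) z := by
  have := isManifold_one (I := I) (M := M)
  have h : ContMDiffAt I I.tangent 1 (fun y => (⟨y, V y⟩ : TangentBundle I M)) x :=
    hV.of_le (by norm_cast)
  filter_upwards [(contMDiffAt_iff_contMDiffAt_nhds (by simp)).1 h] with z hz
  exact hz.mdifferentiableAt (by simp)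

theorem chartForm_extend {k : ℕ} (α : DiffForm I M k) (x : M) (v : Fin k → TangentSpace I x)
    {y : E} (hy : y ∈ (extChartAt I x).target) :
    chartForm α x y v = α ((extChartAt I x).symm y)
      (fun i => FiberBundle.extend E (v i) ((extChartAt I x).symm y)) := by
  have := isManifold_one (I := I) (M := M)
  have hy' : (extChartAt I x).symm y ∈ (chartAt H x).source := by
    simpa using (extChartAt I x).map_target hy
  refine congrArg (α ((extChartAt I x).symm y)) (funext fun i => ?_)
  have h1 := TangentBundle.symmL_trivializationAt (I := I) hy'
  rw [(extChartAt I x).right_inv hy] at h1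
  have h2 : (trivializationAt E (TangentSpace I) x ⟨x, v i⟩).2 = v i := by
    rw [TangentBundle.trivializationAt_apply]
    exact tangentCoordChange_self (I := I) (mem_extChartAt_source x)
  have h3 := congrArg ((trivializationAt E (TangentSpace I) x).symm ((extChartAt I x).symm y)) h2
  refine Eq.trans ?_ h3.symm
  refine Eq.trans ?_ (Trivialization.symmL_apply (R := ℝ) _ (by simpa using hy') _)
  exact (congrArg (fun A : E →L[ℝ] E => A (v i)) h1).symm

section FiniteDimensional

variable [FiniteDimensional ℝ E]

theorem differentiableWithinAt_alternating {F : Type*} [NormedAddCommGroup F] [NormedSpace ℝ F]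
    {k : ℕ} {α : F → E [⋀^Fin k]→L[ℝ] ℝ} {s : Set F} {y : F}
    (h : ∀ v, DifferentiableWithinAt ℝ (fun z => α z v) s y) : DifferentiableWithinAt ℝ α s y := by
  let b := Module.finBasis ℝ E
  let R : E [⋀^Fin k]→L[ℝ] ℝ →ₗ[ℝ] ((Fin k → Fin (finrank ℝ E)) → ℝ) :=
    { toFun := fun f t => f fun i => b (t i)
      map_add' := fun _ _ => rfl
      map_smul' := fun _ _ => rfl }
  have hR : Function.Injective R := fun f g hfg => by
    have h1 : f.toMultilinearMap = g.toMultilinearMap :=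
      Basis.ext_multilinear (fun _ => b) fun t => congrFun hfg t
    ext v
    exact congrArg (fun m : MultilinearMap ℝ (fun _ : Fin k => E) ℝ => m v) h1
  obtain ⟨L, hL⟩ := R.exists_leftInverse_of_injective (LinearMap.ker_eq_bot.2 hR)
  have h1 : DifferentiableWithinAt ℝ (fun z => L.toContinuousLinearMap (R (α z))) s y :=
    L.toContinuousLinearMap.differentiableAt.comp_differentiableWithinAt y
      (differentiableWithinAt_pi.2 fun t => h _)
  exact h1.congr (fun z _ => (LinearMap.congr_fun hL (α z)).symm) (LinearMap.congr_fun hL (α y)).symm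

theorem SmoothFormAt.differentiableWithinAt {k : ℕ} {α : DiffForm I M k} {x : M}
    (hα : SmoothFormAt α x) :
    DifferentiableWithinAt ℝ (chartForm α x) (range I) (extChartAt I x x) := by
  refine differentiableWithinAt_alternating fun v => ?_
  have h := hα (fun i => FiberBundle.extend E (v i : TangentSpace I x))
    (fun i => FiberBundle.contMDiffAt_extend I E _)
  have h2 := differentiableWithinAt_comp_symm (h.mdifferentiableAt (by simp))
  refine h2.congr_of_eventuallyEq ?_ (chartForm_extend α x v (mem_extChartAt_target x))
  filter_upwards [extChartAt_target_mem_nhdsWithin x] with y hy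
  exact chartForm_extend α x v hy

theorem SmoothFormAt.mdifferentiableAt {k : ℕ} {α : DiffForm I M k} {x : M}
    (hα : SmoothFormAt α x) {V : Fin k → Π y : M, TangentSpace I y}
    (hV : ∀ i, MDifferentiableAt I I.tangent (fun y => (⟨y, V i y⟩ : TangentBundle I M)) x) :
    MDifferentiableAt I 𝓘(ℝ, ℝ) (fun y => α y (fun i => V i y)) x := by
  have h1 : DifferentiableWithinAt ℝ (fun y => chartForm α x y (fun i => chartField (V i) x y))
      (range I) (extChartAt I x x) :=
    hα.differentiableWithinAt.continuousAlternatingMap_apply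
      fun i => differentiableWithinAt_chartField (hV i)
  have h2 : DifferentiableWithinAt ℝ (fun y => α ((extChartAt I x).symm y)
      (fun i => V i ((extChartAt I x).symm y))) (range I) (extChartAt I x x) :=
    h1.congr_of_eventuallyEq (eqOn_chartForm_chartField α V x).symm
      (chartForm_chartField α V x (mem_extChartAt_target x)).symm
  refine (mdifferentiableAt_iff _ _).2 ⟨?_, h2⟩
  have h3 := h2.continuousWithinAt.comp_of_eq
    (continuousAt_extChartAt (I := I) x).continuousWithinAt (s := univ)
    (fun z _ => ?_) rfl
  · refine (continuousWithinAt_univ _ _).1 (h3.congr_of_eventuallyEq ?_ ?_)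
    · rw [nhdsWithin_univ]
      filter_upwards [extChartAt_source_mem_nhds (I := I) x] with z hz
      exact (congrArg (fun p => α p fun i => V i p) ((extChartAt I x).left_inv hz)).symm
    · exact (congrArg (fun p => α p fun i => V i p) (extChartAt_to_inv x)).symm
  · simp

/-- The formula for the exterior derivative in terms of vector fields. -/
theorem SmoothFormAt.extD_apply {k : ℕ} {α : DiffForm I M (k + 1)} {x : M}
    (hα : SmoothFormAt α x) {V : Fin (k + 2) → Π y : M, TangentSpace I y}
    (hV : ∀ i, MDifferentiableAt I I.tangent (fun y => (⟨y, V i y⟩ : TangentBundle I M)) x) :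
    extD α x (fun i => V i x) =
      (∑ i, (-1 : ℝ) ^ i.val * mvfderiv I (fun y => α y (i.removeNth (fun j => V j y))) x (V i x)) -
        ∑ i : Fin (k + 1), ∑ j ≥ i, (-1 : ℝ) ^ (i + j : ℕ) *
          α x (Matrix.vecCons (VectorField.mlieBracket I (V i.castSucc) (V j.succ) x)
            (j.removeNth <| i.castSucc.removeNth (fun l => V l x))) := by
  have hV' := fun i => differentiableWithinAt_chartField (hV i)
  have h := extDerivWithin_apply_vectorField hα.differentiableWithinAt hV'
    (I.uniqueDiffOn _ (mem_range_self _))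
  simp only [chartField_self, ← mlieBracket_eq, zsmul_eq_mul, Int.cast_pow, Int.cast_neg,
    Int.cast_one] at h
  refine (extD_eq α x _).trans (h.trans ?_)
  congr 1
  · refine Finset.sum_congr rfl fun i _ => ?_
    rw [mvfderiv_eq]
    · exact congrArg (fun A : E →L[ℝ] ℝ => (-1 : ℝ) ^ i.val * A (V i x))
        ((eqOn_chartForm_chartField α (fun j => V (i.succAbove j)) x).fderivWithin_eq
          (chartForm_chartField α (fun j => V (i.succAbove j)) x (mem_extChartAt_target x)))
    · exact hα.mdifferentiableAt fun j => hV (i.succAbove j)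
  · refine Finset.sum_congr rfl fun i _ => Finset.sum_congr rfl fun j _ => ?_
    congr 1
    exact chartForm_self α x _

theorem contMDiffAt_mlieBracket {V W : Π y : M, TangentSpace I y} {x : M}
    (hV : ContMDiffAt I I.tangent ∞ (fun y => (⟨y, V y⟩ : TangentBundle I M)) x)
    (hW : ContMDiffAt I I.tangent ∞ (fun y => (⟨y, W y⟩ : TangentBundle I M)) x) :
    ContMDiffAt I I.tangent ∞
      (fun y => (⟨y, VectorField.mlieBracket I V W y⟩ : TangentBundle I M)) x := by
  have : IsManifold I (((⊤ : ℕ∞) : ℕ∞ω) + 1) M := (inferInstance : IsManifold I ∞ M)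
  have : IsManifold I (minSmoothness ℝ 2) M := by
    rw [minSmoothness_of_isRCLikeNormedField]
    exact isManifold_two
  exact ContMDiffAt.mlieBracket_vectorField (n := ⊤) (m := ⊤) hV hW (by simp)

theorem SmoothFormAt.extD {k : ℕ} {α : DiffForm I M (k + 1)} {x : M} (hα : ∀ y, SmoothFormAt α y) :
    SmoothFormAt (extD α) x := by
  intro V hV
  have h : (fun y => TorsionGeometry.extD α y (fun i => V i y)) =ᶠ[𝓝 x] fun y =>
      (∑ i, (-1 : ℝ) ^ i.val * mvfderiv I (fun y => α y (i.removeNth (fun j => V j y))) y (V i y)) -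
        ∑ i : Fin (k + 1), ∑ j ≥ i, (-1 : ℝ) ^ (i + j : ℕ) *
          α y (Matrix.vecCons (VectorField.mlieBracket I (V i.castSucc) (V j.succ) y)
            (j.removeNth <| i.castSucc.removeNth (fun l => V l y))) := by
    filter_upwards [Filter.eventually_all.2 fun i => eventually_mdifferentiableAt_section (hV i)]
      with y hy
    exact (hα y).extD_apply hy
  refine ContMDiffAt.congr_of_eventuallyEq ?_ h
  refine ContMDiffAt.sub (ContMDiffAt.sum fun i _ => ?_)
    (ContMDiffAt.sum fun i _ => ContMDiffAt.sum fun j _ => ?_)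
  · exact contMDiffAt_const.mul (contMDiffAt_mvfderiv (hα x _ fun j => hV (i.succAbove j)) (hV i))
  · refine contMDiffAt_const.mul ?_
    have h2 := hα x (Matrix.vecCons (VectorField.mlieBracket I (V i.castSucc) (V j.succ))
      (j.removeNth <| i.castSucc.removeNth V)) ?_
    · refine h2.congr_of_eventuallyEq (Filter.Eventually.of_forall fun y => ?_)
      refine congrArg (α y) (funext fun l => ?_)
      refine Fin.cases ?_ (fun l => ?_) l <;> rfl
    · intro l
      refine Fin.cases ?_ (fun l => ?_) l
      · exact contMDiffAt_mlieBracket (hV _) (hV _)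
      · exact hV _

theorem SmoothFormAt.extD_one {α : DiffForm I M 1} {x : M} (hα : SmoothFormAt α x)
    {X Y : Π y : M, TangentSpace I y}
    (hX : MDifferentiableAt I I.tangent (fun y => (⟨y, X y⟩ : TangentBundle I M)) x)
    (hY : MDifferentiableAt I I.tangent (fun y => (⟨y, Y y⟩ : TangentBundle I M)) x) :
    TorsionGeometry.extD α x ![X x, Y x] =
      mvfderiv I (fun y => α y ![Y y]) x (X x) - mvfderiv I (fun y => α y ![X y]) x (Y x)
        - α x ![VectorField.mlieBracket I X Y x] := by
  have h := hα.extD_apply (V := ![X, Y]) (by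
    intro i
    fin_cases i <;> assumption)
  have e : ∀ y, (fun i => ![X, Y] i y) = ![X y, Y y] := fun y => by ext i; fin_cases i <;> rfl
  have s1 : ∀ f : Fin 2 → ℝ, ∑ i, (-1 : ℝ) ^ i.val * f i = f 0 - f 1 := fun f => by
    simp [Fin.sum_univ_succ]; ring
  have s2 : ∀ f : Fin 1 → Fin 1 → ℝ, ∑ i : Fin 1, ∑ j ≥ i, (-1 : ℝ) ^ (i + j : ℕ) * f i j
      = f 0 0 := fun f => by
    simp [show Finset.Ici (0 : Fin 1) = {0} by decide]
  rw [e, s1, s2] at h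
  simp only [e] at h
  rw [h]
  refine congrArg₂ (· - ·) (congrArg₂ (· - ·) ?_ ?_) ?_
  · exact congrArg (fun f : M → ℝ => mvfderiv I f x (X x))
      (funext fun y => congrArg (α y) (by ext i; fin_cases i <;> rfl))
  · exact congrArg (fun f : M → ℝ => mvfderiv I f x (Y x))
      (funext fun y => congrArg (α y) (by ext i; fin_cases i <;> rfl))
  · exact congrArg (α x) (by ext i; fin_cases i; rfl)

theorem SmoothFormAt.extD_two {α : DiffForm I M 2} {x : M} (hα : SmoothFormAt α x)
    {X Y Z : Π y : M, TangentSpace I y}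
    (hX : MDifferentiableAt I I.tangent (fun y => (⟨y, X y⟩ : TangentBundle I M)) x)
    (hY : MDifferentiableAt I I.tangent (fun y => (⟨y, Y y⟩ : TangentBundle I M)) x)
    (hZ : MDifferentiableAt I I.tangent (fun y => (⟨y, Z y⟩ : TangentBundle I M)) x) :
    TorsionGeometry.extD α x ![X x, Y x, Z x] =
      mvfderiv I (fun y => α y ![Y y, Z y]) x (X x) - mvfderiv I (fun y => α y ![X y, Z y]) x (Y x)
        + mvfderiv I (fun y => α y ![X y, Y y]) x (Z x)
        - α x ![VectorField.mlieBracket I X Y x, Z x] + α x ![VectorField.mlieBracket I X Z x, Y x]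
        - α x ![VectorField.mlieBracket I Y Z x, X x] := by
  have h := hα.extD_apply (V := ![X, Y, Z]) (by
    intro i
    fin_cases i <;> assumption)
  have e : ∀ y, (fun i => ![X, Y, Z] i y) = ![X y, Y y, Z y] :=
    fun y => by ext i; fin_cases i <;> rfl
  have s1 : ∀ f : Fin 3 → ℝ, ∑ i, (-1 : ℝ) ^ i.val * f i = f 0 - f 1 + f 2 := fun f => by
    simp [Fin.sum_univ_succ]; ring
  have s2 : ∀ f : Fin 2 → Fin 2 → ℝ, ∑ i : Fin 2, ∑ j ≥ i, (-1 : ℝ) ^ (i + j : ℕ) * f i j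
      = f 0 0 - f 0 1 + f 1 1 := fun f => by
    simp [Fin.sum_univ_succ, show Finset.Ici (0 : Fin 2) = {0, 1} by decide,
      show Finset.Ici (1 : Fin 2) = {1} by decide]
    ring
  rw [e, s1, s2] at h
  simp only [e] at h
  have hs : ∀ a b c d e f : ℝ, a - b + c - d + e - f = a - b + c - (d - e + f) := by
    intros; ring
  rw [h, hs]
  refine congrArg₂ (· - ·) (congrArg₂ (· + ·) (congrArg₂ (· - ·) ?_ ?_) ?_)
    (congrArg₂ (· + ·) (congrArg₂ (· - ·) ?_ ?_) ?_)
  · exact congrArg (fun f : M → ℝ => mvfderiv I f x (X x))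
      (funext fun y => congrArg (α y) (by ext i; fin_cases i <;> rfl))
  · exact congrArg (fun f : M → ℝ => mvfderiv I f x (Y x))
      (funext fun y => congrArg (α y) (by ext i; fin_cases i <;> rfl))
  · exact congrArg (fun f : M → ℝ => mvfderiv I f x (Z x))
      (funext fun y => congrArg (α y) (by ext i; fin_cases i <;> rfl))
  · exact congrArg (α x) (by ext i; fin_cases i <;> rfl)
  · exact congrArg (α x) (by ext i; fin_cases i <;> rfl)
  · exact congrArg (α x) (by ext i; fin_cases i <;> rfl)

end FiniteDimensional

end Calculus

section ThreeForm

variable {V : Type*} [AddCommGroup V] [Module ℝ V] [TopologicalSpace V]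
  (c : V [⋀^Fin 3]→L[ℝ] ℝ) (a a' b d : V) (r : ℝ)

theorem map_swap_left : c ![b, a, d] = -c ![a, b, d] := by
  have h := c.toAlternatingMap.map_swap ![a, b, d] (i := 0) (j := 1) (by decide)
  have e : ![a, b, d] ∘ Equiv.swap (0 : Fin 3) 1 = ![b, a, d] := by ext i; fin_cases i <;> rfl
  rw [e] at h
  exact h

theorem map_swap_right : c ![a, d, b] = -c ![a, b, d] := by
  have h := c.toAlternatingMap.map_swap ![a, b, d] (i := 1) (j := 2) (by decide)
  have e : ![a, b, d] ∘ Equiv.swap (1 : Fin 3) 2 = ![a, d, b] := by ext i; fin_cases i <;> rfl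
  rw [e] at h
  exact h

theorem map_rotate : c ![b, d, a] = c ![a, b, d] := by
  rw [map_swap_right c b a d, map_swap_left, neg_neg]

theorem map_smul_fst : c ![r • a, b, d] = r * c ![a, b, d] := by
  have h := c.map_update_smul ![a, b, d] 0 r a
  have e : ∀ v, Function.update ![a, b, d] 0 v = ![v, b, d] := fun v => by
    ext i; fin_cases i <;> rfl
  rw [e, e] at h
  exact h

theorem map_add_fst : c ![a + a', b, d] = c ![a, b, d] + c ![a', b, d] := by
  have h := c.map_update_add ![a, b, d] 0 a a'
  have e : ∀ v, Function.update ![a, b, d] 0 v = ![v, b, d] := fun v => by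
    ext i; fin_cases i <;> rfl
  rw [e, e, e] at h
  exact h

theorem map_smul_snd : c ![b, r • a, d] = r * c ![b, a, d] := by
  rw [map_swap_left, map_smul_fst, map_swap_left c a b, mul_neg]

theorem map_add_snd : c ![b, a + a', d] = c ![b, a, d] + c ![b, a', d] := by
  rw [map_swap_left, map_add_fst, map_swap_left c a b, map_swap_left c a' b, neg_add]

theorem map_smul_thd : c ![b, d, r • a] = r * c ![b, d, a] := by
  rw [map_swap_right, map_smul_snd, map_swap_right c b a, mul_neg]

theorem map_add_thd : c ![b, d, a + a'] = c ![b, d, a] + c ![b, d, a'] := by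
  rw [map_swap_right, map_add_snd, map_swap_right c b a, map_swap_right c b a', neg_add]

end ThreeForm

section Connection

variable {E : Type*} [NormedAddCommGroup E] [NormedSpace ℝ E]
  {H : Type*} [TopologicalSpace H] {I : ModelWithCorners ℝ E H}
  {M : Type*} [TopologicalSpace M] [ChartedSpace H M]

variable [IsManifold I ∞ M]

/-- Differentiability of a vector field at a point. -/
abbrev MDiffField (V : Π y : M, TangentSpace I y) (x : M) : Prop :=
  MDifferentiableAt I I.tangent (fun y => (⟨y, V y⟩ : TangentBundle I M)) x

/-- Smoothness of a vector field at a point. -/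
abbrev SmoothField (V : Π y : M, TangentSpace I y) (x : M) : Prop :=
  ContMDiffAt I I.tangent ∞ (fun y => (⟨y, V y⟩ : TangentBundle I M)) x

theorem SmoothField.mdiff {V : Π y : M, TangentSpace I y} {x : M} (hV : SmoothField V x) :
    MDiffField V x :=
  hV.mdifferentiableAt (by simp)

theorem smoothField_extend {x : M} (v : TangentSpace I x) :
    SmoothField (FiberBundle.extend E v) x :=
  FiberBundle.contMDiffAt_extend I E v

theorem mdiffField_extend {x : M} (v : TangentSpace I x) :
    MDiffField (FiberBundle.extend E v) x :=
  (smoothField_extend v).mdiff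

section Endomorphism

variable {J : Π x : M, TangentSpace I x →L[ℝ] TangentSpace I x}
  (hJ : ContMDiff I (I.prod 𝓘(ℝ, E →L[ℝ] E)) ∞
    (fun x => TotalSpace.mk' (E →L[ℝ] E) (E := fun y : M => TangentSpace I y →L[ℝ] TangentSpace I y)
      x (J x)))

include hJ

theorem SmoothField.endo {V : Π y : M, TangentSpace I y} {x : M} (hV : SmoothField V x) :
    SmoothField (fun y => J y (V y)) x :=
  ContMDiffAt.clm_bundle_apply (F₁ := E) (F₂ := E) (b := fun y : M => y) hJ.contMDiffAt hV

theorem MDiffField.endo {V : Π y : M, TangentSpace I y} {x : M} (hV : MDiffField V x) :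
    MDiffField (fun y => J y (V y)) x :=
  MDifferentiableAt.clm_bundle_apply (F₁ := E) (F₂ := E) (b := fun y : M => y)
    (hJ.contMDiffAt.mdifferentiableAt (by simp)) hV

end Endomorphism

section Metric

variable (g : RiemMetric I M)

theorem contMDiffAt_inner {X Y : Π y : M, TangentSpace I y} {x : M} (hX : SmoothField X x)
    (hY : SmoothField Y x) :
    ContMDiffAt I 𝓘(ℝ, ℝ) ∞ (fun y => g.inner y (X y) (Y y)) x := by
  have h := ContMDiffAt.clm_bundle_apply₂ (F₁ := E) (F₂ := E) (F₃ := ℝ)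
    (E₃ := Bundle.Trivial M ℝ) (b := fun y : M => y) g.contMDiff.contMDiffAt hX hY
  exact (contMDiffAt_totalSpace.1 h).2

theorem mdifferentiableAt_inner {X Y : Π y : M, TangentSpace I y} {x : M} (hX : MDiffField X x)
    (hY : MDiffField Y x) :
    MDifferentiableAt I 𝓘(ℝ, ℝ) (fun y => g.inner y (X y) (Y y)) x := by
  have h := MDifferentiableAt.clm_bundle_apply₂ (F₁ := E) (F₂ := E) (F₃ := ℝ)
    (E₃ := Bundle.Trivial M ℝ) (b := fun y : M => y)
    (g.contMDiff.contMDiffAt.mdifferentiableAt (by simp)) hX hY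
  exact ((mdifferentiableAt_totalSpace _ _).1 h).2

theorem inner_eq_zero_of_self {x : M} {a : TangentSpace I x} (h : g.inner x a a = 0) : a = 0 := by
  by_contra ha
  exact (g.pos x a ha).ne' h

theorem eq_of_inner {x : M} {a b : TangentSpace I x}
    (h : ∀ Z : Π y : M, TangentSpace I y, SmoothField Z x →
      g.inner x a (Z x) = g.inner x b (Z x)) : a = b := by
  rw [← sub_eq_zero]
  refine inner_eq_zero_of_self g ?_
  have h1 := h _ (smoothField_extend (a - b))
  rw [FiberBundle.extend_apply_self] at h1
  exact (congrArg (fun f : E →L[ℝ] ℝ => f (a - b)) (map_sub (g.inner x) a b)).trans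
    (sub_eq_zero.2 h1)

section Derivative

variable {g} {X X' Y Y' : Π y : M, TangentSpace I y} {x : M} {f : M → ℝ}

theorem mvfderiv_inner_smul_left (hf : MDifferentiableAt I 𝓘(ℝ, ℝ) f x) (hX : MDiffField X x)
    (hY : MDiffField Y x) (v : TangentSpace I x) :
    mvfderiv I (fun y => g.inner y ((f • X) y) (Y y)) x v
      = f x * mvfderiv I (fun y => g.inner y (X y) (Y y)) x v
        + g.inner x (X x) (Y x) * mvfderiv I f x v := by
  have h1 : (fun y => g.inner y ((f • X) y) (Y y)) = fun y => f y * g.inner y (X y) (Y y) := by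
    funext y
    simp
  rw [h1, mvfderiv_fun_mul hf (mdifferentiableAt_inner g hX hY)]
  rfl

theorem mvfderiv_inner_smul_right (hf : MDifferentiableAt I 𝓘(ℝ, ℝ) f x) (hX : MDiffField X x)
    (hY : MDiffField Y x) (v : TangentSpace I x) :
    mvfderiv I (fun y => g.inner y (X y) ((f • Y) y)) x v
      = f x * mvfderiv I (fun y => g.inner y (X y) (Y y)) x v
        + g.inner x (X x) (Y x) * mvfderiv I f x v := by
  have h1 : (fun y => g.inner y (X y) ((f • Y) y)) = fun y => f y * g.inner y (X y) (Y y) := by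
    funext y
    simp
  rw [h1, mvfderiv_fun_mul hf (mdifferentiableAt_inner g hX hY)]
  rfl

theorem mvfderiv_inner_add_left (hX : MDiffField X x) (hX' : MDiffField X' x)
    (hY : MDiffField Y x) (v : TangentSpace I x) :
    mvfderiv I (fun y => g.inner y ((X + X') y) (Y y)) x v
      = mvfderiv I (fun y => g.inner y (X y) (Y y)) x v
        + mvfderiv I (fun y => g.inner y (X' y) (Y y)) x v := by
  have h1 : (fun y => g.inner y ((X + X') y) (Y y))
      = fun y => g.inner y (X y) (Y y) + g.inner y (X' y) (Y y) := by
    funext y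
    simp
  rw [h1, mvfderiv_fun_add (mdifferentiableAt_inner g hX hY) (mdifferentiableAt_inner g hX' hY)]
  rfl

theorem inner_fun_symm (X Y : Π y : M, TangentSpace I y) :
    (fun y => g.inner y (X y) (Y y)) = fun y => g.inner y (Y y) (X y) :=
  funext fun y => g.symm y _ _

theorem mvfderiv_inner_add_right (hX : MDiffField X x) (hY : MDiffField Y x)
    (hY' : MDiffField Y' x) (v : TangentSpace I x) :
    mvfderiv I (fun y => g.inner y (X y) ((Y + Y') y)) x v
      = mvfderiv I (fun y => g.inner y (X y) (Y y)) x v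
        + mvfderiv I (fun y => g.inner y (X y) (Y' y)) x v := by
  rw [inner_fun_symm, mvfderiv_inner_add_left hY hY' hX, inner_fun_symm, inner_fun_symm Y']

end Derivative

variable [FiniteDimensional ℝ E]

theorem isInvertible_inner (x : M) :
    (g.inner x : E →L[ℝ] E →L[ℝ] ℝ).IsInvertible := by
  let G' : E →L[ℝ] E →L[ℝ] ℝ := g.inner x
  let G : E →ₗ[ℝ] (E →L[ℝ] ℝ) := G'
  have hG : Function.Injective G := by
    refine (injective_iff_map_eq_zero G).2 fun a ha => ?_
    exact inner_eq_zero_of_self g (x := x) (a := a) (congrArg (fun f : E →L[ℝ] ℝ => f a) ha)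
  have hfin : finrank ℝ E = finrank ℝ (E →L[ℝ] ℝ) := by
    rw [← (LinearMap.toContinuousLinearMap (𝕜 := ℝ) (E := E) (F' := ℝ)).finrank_eq,
      Subspace.dual_finrank_eq]
  refine ⟨(LinearEquiv.ofInjectiveOfFinrankEq G hG hfin).toContinuousLinearEquiv, ?_⟩
  ext a
  rfl

/-- The inverse of the isomorphism `a ↦ g(a, ·)`. -/
def sharp (x : M) : (TangentSpace I x →L[ℝ] ℝ) →L[ℝ] TangentSpace I x :=
  (g.inner x : E →L[ℝ] E →L[ℝ] ℝ).inverse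

theorem inner_sharp (x : M) (a : TangentSpace I x →L[ℝ] ℝ) (v : TangentSpace I x) :
    g.inner x (sharp g x a) v = a v :=
  congrArg (fun f : E →L[ℝ] ℝ => f v) ((isInvertible_inner g x).self_apply_inverse a)

theorem smoothField_of_inner {V : Π y : M, TangentSpace I y} {x₀ : M}
    (h : ∀ Z : Π y : M, TangentSpace I y, SmoothField Z x₀ →
      ContMDiffAt I 𝓘(ℝ, ℝ) ∞ (fun y => g.inner y (V y) (Z y)) x₀) :
    SmoothField V x₀ := by
  have hb := contMDiffAt_hom (I := I) (F₁ := E) (F₂ := ℝ) (V₁ := fun y : M => TangentSpace I y)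
    (V₂ := Bundle.Trivial M ℝ) (fun y => g.inner y (V y)) x₀ fun Z hZ => by
      rw [contMDiffAt_totalSpace]
      exact ⟨contMDiffAt_id, h Z hZ⟩
  have hG := (contMDiffAt_hom_bundle _).1 (g.contMDiff.contMDiffAt (x := x₀))
  rw [contMDiffAt_totalSpace] at hb
  refine contMDiffAt_totalSpace.2 ⟨contMDiffAt_id, ?_⟩
  set G := fun x => ContinuousLinearMap.inCoordinates E (TangentSpace I) (E →L[ℝ] ℝ)
    (fun b : M => TangentSpace I b →L[ℝ] ℝ) x₀ x x₀ x (g.inner x) with hGdef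
  set b' := fun x => (trivializationAt (E →L[ℝ] ℝ) (fun b : M => TangentSpace I b →L[ℝ] ℝ) x₀
    ⟨x, g.inner x (V x)⟩).2 with hb'
  have key : ∀ x ∈ (trivializationAt E (TangentSpace I) x₀).baseSet,
      x ∈ (trivializationAt (E →L[ℝ] ℝ) (fun b : M => TangentSpace I b →L[ℝ] ℝ) x₀).baseSet →
      (G x).IsInvertible ∧ G x (trivializationAt E (TangentSpace I) x₀ ⟨x, V x⟩).2 = b' x := by
    intro x hx hx'
    have h1 := ContinuousLinearMap.inCoordinates_eq (σ := RingHom.id ℝ) (ϕ := g.inner x) hx hx'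
    have h2 : (g.inner x).IsInvertible := isInvertible_inner g x
    constructor
    · refine Eq.mpr (congrArg ContinuousLinearMap.IsInvertible h1) ?_
      exact ContinuousLinearMap.isInvertible_equiv.comp
        (h2.comp ContinuousLinearMap.isInvertible_equiv)
    · have h3 := congrArg (fun A => A (trivializationAt E (TangentSpace I) x₀ ⟨x, V x⟩).2) h1
      refine h3.trans ?_
      have h4 := ((trivializationAt E (TangentSpace I) x₀).continuousLinearEquivAt ℝ x
        hx).symm_apply_apply (V x)
      exact congrArg (fun v => ((trivializationAt (E →L[ℝ] ℝ)
        (fun b : M => TangentSpace I b →L[ℝ] ℝ) x₀).continuousLinearEquivAt ℝ x hx')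
          (g.inner x v)) h4
  have hx₀ := FiberBundle.mem_baseSet_trivializationAt' (F := E) (E := TangentSpace I) x₀
  have hx₀' := FiberBundle.mem_baseSet_trivializationAt' (F := E →L[ℝ] ℝ)
    (E := fun b : M => TangentSpace I b →L[ℝ] ℝ) x₀
  obtain ⟨e, he⟩ := (key x₀ hx₀ hx₀').1
  have h2 : ContMDiffAt I 𝓘(ℝ, (E →L[ℝ] ℝ) →L[ℝ] E) ∞ (fun x => (G x).inverse) x₀ := by
    have h3 : ContDiffAt ℝ ∞ (ContinuousLinearMap.inverse (R := ℝ) (M := E) (M₂ := E →L[ℝ] ℝ))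
        (G x₀) := he ▸ contDiffAt_map_inverse e
    exact h3.contMDiffAt.comp x₀ hG.2
  refine (h2.clm_apply hb.2).congr_of_eventuallyEq ?_
  filter_upwards [(trivializationAt E (TangentSpace I) x₀).open_baseSet.mem_nhds hx₀,
    (trivializationAt (E →L[ℝ] ℝ) (fun b : M => TangentSpace I b →L[ℝ] ℝ) x₀).open_baseSet.mem_nhds
      hx₀'] with x hx hx'
  obtain ⟨h3, h4⟩ := key x hx hx'
  exact (h3.inverse_apply_eq.2 h4.symm).symm

/-- The right hand side of the Koszul formula for the connection with torsion `c`. -/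
def koszul (c : DiffForm I M 3) (X Y Z : Π y : M, TangentSpace I y) (x : M) : ℝ :=
  mvfderiv I (fun y => g.inner y (Y y) (Z y)) x (X x)
    + mvfderiv I (fun y => g.inner y (X y) (Z y)) x (Y x)
    - mvfderiv I (fun y => g.inner y (X y) (Y y)) x (Z x)
    + g.inner x (VectorField.mlieBracket I X Y x) (Z x)
    - g.inner x (VectorField.mlieBracket I X Z x) (Y x)
    - g.inner x (VectorField.mlieBracket I Y Z x) (X x)
    + c x ![X x, Y x, Z x]

section Koszul

variable {g} {c : DiffForm I M 3} {X X' Y Y' Z Z' : Π y : M, TangentSpace I y} {x : M} {f : M → ℝ}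

theorem koszul_smul_left (hf : MDifferentiableAt I 𝓘(ℝ, ℝ) f x) (hX : MDiffField X x)
    (hY : MDiffField Y x) (hZ : MDiffField Z x) :
    koszul g c (f • X) Y Z x = f x * koszul g c X Y Z x := by
  have h1 : VectorField.mlieBracket I (f • X) Y x
    = -mvfderiv I f x (Y x) • X x + f x • VectorField.mlieBracket I X Y x :=
    VectorField.mlieBracket_smul_left hf hX
  have h2 : VectorField.mlieBracket I (f • X) Z x
    = -mvfderiv I f x (Z x) • X x + f x • VectorField.mlieBracket I X Z x :=
    VectorField.mlieBracket_smul_left hf hX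
  simp only [koszul]
  rw [mvfderiv_inner_smul_left hf hX hZ, mvfderiv_inner_smul_left hf hX hY, h1, h2]
  simp only [Pi.smul_apply', map_add, map_smul, map_neg, neg_smul, add_apply, smul_apply,
    neg_apply, smul_eq_mul, map_smul_fst]
  ring

theorem koszul_add_left (hX : MDiffField X x) (hX' : MDiffField X' x)
    (hY : MDiffField Y x) (hZ : MDiffField Z x) :
    koszul g c (X + X') Y Z x = koszul g c X Y Z x + koszul g c X' Y Z x := by
  simp only [koszul]
  rw [mvfderiv_inner_add_left hX hX' hZ, mvfderiv_inner_add_left hX hX' hY,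
    VectorField.mlieBracket_add_left hX hX', VectorField.mlieBracket_add_left hX hX']
  simp only [Pi.add_apply, map_add, add_apply, map_add_fst]
  ring

theorem koszul_smul_right (hf : MDifferentiableAt I 𝓘(ℝ, ℝ) f x) (hX : MDiffField X x)
    (hY : MDiffField Y x) (hZ : MDiffField Z x) :
    koszul g c X Y (f • Z) x = f x * koszul g c X Y Z x := by
  have h1 : VectorField.mlieBracket I X (f • Z) x
    = mvfderiv I f x (X x) • Z x + f x • VectorField.mlieBracket I X Z x :=
    VectorField.mlieBracket_smul_right hf hZ
  have h2 : VectorField.mlieBracket I Y (f • Z) x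
    = mvfderiv I f x (Y x) • Z x + f x • VectorField.mlieBracket I Y Z x :=
    VectorField.mlieBracket_smul_right hf hZ
  simp only [koszul]
  rw [mvfderiv_inner_smul_right hf hX hZ, mvfderiv_inner_smul_right hf hY hZ, h1, h2]
  simp only [Pi.smul_apply', map_add, map_smul, add_apply, smul_apply, smul_eq_mul, map_smul_thd,
    g.symm x (Z x)]
  ring

theorem koszul_add_right (hX : MDiffField X x) (hY : MDiffField Y x) (hZ : MDiffField Z x)
    (hZ' : MDiffField Z' x) :
    koszul g c X Y (Z + Z') x = koszul g c X Y Z x + koszul g c X Y Z' x := by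
  simp only [koszul]
  rw [mvfderiv_inner_add_right hX hZ hZ', mvfderiv_inner_add_right hY hZ hZ',
    VectorField.mlieBracket_add_right hZ hZ', VectorField.mlieBracket_add_right hZ hZ']
  simp only [Pi.add_apply, map_add, add_apply, map_add_thd]
  ring

theorem koszul_smul_middle (hf : MDifferentiableAt I 𝓘(ℝ, ℝ) f x) (hX : MDiffField X x)
    (hY : MDiffField Y x) (hZ : MDiffField Z x) :
    koszul g c X (f • Y) Z x
      = f x * koszul g c X Y Z x + 2 * mvfderiv I f x (X x) * g.inner x (Y x) (Z x) := by
  have h1 : VectorField.mlieBracket I X (f • Y) x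
    = mvfderiv I f x (X x) • Y x + f x • VectorField.mlieBracket I X Y x :=
    VectorField.mlieBracket_smul_right hf hY
  have h2 : VectorField.mlieBracket I (f • Y) Z x
    = -mvfderiv I f x (Z x) • Y x + f x • VectorField.mlieBracket I Y Z x :=
    VectorField.mlieBracket_smul_left hf hY
  simp only [koszul]
  rw [mvfderiv_inner_smul_left hf hY hZ, mvfderiv_inner_smul_right hf hX hY, h1, h2]
  simp only [Pi.smul_apply', map_add, map_smul, map_neg, neg_smul, add_apply, smul_apply,
    neg_apply, smul_eq_mul, map_smul_snd, g.symm x (Y x)]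
  ring

theorem koszul_add_middle (hX : MDiffField X x) (hY : MDiffField Y x) (hY' : MDiffField Y' x)
    (hZ : MDiffField Z x) :
    koszul g c X (Y + Y') Z x = koszul g c X Y Z x + koszul g c X Y' Z x := by
  simp only [koszul]
  rw [mvfderiv_inner_add_left hY hY' hZ, mvfderiv_inner_add_right hX hY hY',
    VectorField.mlieBracket_add_left hY hY', VectorField.mlieBracket_add_right hY hY']
  simp only [Pi.add_apply, map_add, add_apply, map_add_snd]
  ring

theorem tensorialAt_koszul_left (hY : MDiffField Y x) (hZ : MDiffField Z x) :
    TensorialAt I E (fun X => koszul g c X Y Z x) x where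
  smul hf hX := koszul_smul_left hf hX hY hZ
  add hX hX' := koszul_add_left hX hX' hY hZ

theorem tensorialAt_koszul_right (hX : MDiffField X x) (hY : MDiffField Y x) :
    TensorialAt I E (fun Z => koszul g c X Y Z x) x where
  smul hf hZ := koszul_smul_right hf hX hY hZ
  add hZ hZ' := koszul_add_right hX hY hZ hZ'

end Koszul

open scoped Classical in
/-- The metric connection with torsion `c`, as a function. -/
def koszulDeriv (c : DiffForm I M 3) (Y : Π y : M, TangentSpace I y) (x : M) :
    TangentSpace I x →L[ℝ] TangentSpace I x :=
  if hY : MDiffField Y x then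
    ((2 : ℝ)⁻¹ • sharp g x).comp (TensorialAt.mkHom₂ (fun X Z => koszul g c X Y Z x) x
      (fun _ hZ => tensorialAt_koszul_left hY hZ) (fun _ hX => tensorialAt_koszul_right hX hY))
  else 0

theorem inner_koszulDeriv (c : DiffForm I M 3) {X Y Z : Π y : M, TangentSpace I y} {x : M}
    (hX : MDiffField X x) (hY : MDiffField Y x) (hZ : MDiffField Z x) :
    g.inner x (koszulDeriv g c Y x (X x)) (Z x) = 2⁻¹ * koszul g c X Y Z x := by
  rw [koszulDeriv, dif_pos hY, ContinuousLinearMap.comp_apply, smul_apply, map_smul, smul_apply,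
    inner_sharp, smul_eq_mul]
  congr 1
  exact TensorialAt.mkHom₂_apply _ _ hX hZ

theorem isCovariantDerivativeOn_koszulDeriv (c : DiffForm I M 3) :
    IsCovariantDerivativeOn E (koszulDeriv g c) where
  add {Y Y' x} hY hY' _ := by
    ext v
    refine eq_of_inner g fun Z hZ => ?_
    have hv := mdiffField_extend v
    have hYY : MDiffField (Y + Y') x := mdifferentiableAt_add_section hY hY'
    have h := koszul_add_middle (g := g) (c := c) hv hY hY' hZ.mdiff
    have h1 := inner_koszulDeriv g c hv hYY hZ.mdiff
    have h2 := inner_koszulDeriv g c hv hY hZ.mdiff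
    have h3 := inner_koszulDeriv g c hv hY' hZ.mdiff
    rw [FiberBundle.extend_apply_self] at h1 h2 h3
    rw [h1, h, add_apply, map_add, add_apply, h2, h3]
    ring
  leibniz {Y f x} hY hf _ := by
    ext v
    refine eq_of_inner g fun Z hZ => ?_
    have hv := mdiffField_extend v
    have hYY : MDiffField (f • Y) x := hf.smul_section hY
    have h := koszul_smul_middle (g := g) (c := c) hf hv hY hZ.mdiff
    have h1 := inner_koszulDeriv g c hv hYY hZ.mdiff
    have h2 := inner_koszulDeriv g c hv hY hZ.mdiff
    rw [FiberBundle.extend_apply_self] at h h1 h2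
    rw [h1, h, add_apply, map_add, add_apply, smul_apply, map_smul, smul_apply, h2,
      ContinuousLinearMap.smulRight_apply, map_smul, smul_apply]
    simp only [smul_eq_mul]
    ring

/-- The metric connection with torsion `c`. -/
def koszulConnection (c : DiffForm I M 3) :
    CovariantDerivative I E (fun x : M => TangentSpace I x) :=
  ⟨koszulDeriv g c, isCovariantDerivativeOn_koszulDeriv g c⟩


end Metric

end Connection

section Hermitian

variable {E : Type*} [NormedAddCommGroup E] [NormedSpace ℝ E]
  {H : Type*} [TopologicalSpace H] {I : ModelWithCorners ℝ E H}
  {M : Type*} [TopologicalSpace M] [ChartedSpace H M] [IsManifold I ∞ M]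

theorem koszul_metric (g : RiemMetric I M) (c : DiffForm I M 3)
    (X Y Z : Π y : M, TangentSpace I y) (x : M) :
    koszul g c X Y Z x + koszul g c X Z Y x
      = 2 * mvfderiv I (fun y => g.inner y (Y y) (Z y)) x (X x) := by
  simp only [koszul]
  rw [inner_fun_symm (g := g) Z Y, VectorField.mlieBracket_swap_apply (V := Z) (W := Y),
    map_swap_right]
  simp only [map_neg, neg_apply]
  ring

theorem koszul_torsion (g : RiemMetric I M) (c : DiffForm I M 3) (X Y Z : Π y : M, TangentSpace I y)
    (x : M) :
    koszul g c X Y Z x - koszul g c Y X Z x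
      = 2 * (g.inner x (VectorField.mlieBracket I X Y x) (Z x) + c x ![X x, Y x, Z x]) := by
  simp only [koszul]
  rw [inner_fun_symm (g := g) Y X, VectorField.mlieBracket_swap_apply (V := Y) (W := X),
    map_swap_left (c x) (X x)]
  simp only [map_neg, neg_apply]
  ring

theorem koszulDeriv_torsion [FiniteDimensional ℝ E] (g : RiemMetric I M) (c : DiffForm I M 3)
    (x : M) (u v w : TangentSpace I x) :
    g.inner x ((koszulConnection g c).torsion x u v) w = c x ![u, v, w] := by
  have hu := mdiffField_extend u
  have hv := mdiffField_extend v
  have hw := mdiffField_extend w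
  have h1 := inner_koszulDeriv g c hu hv hw
  have h2 := inner_koszulDeriv g c hv hu hw
  have h := koszul_torsion g c (FiberBundle.extend E u) (FiberBundle.extend E v)
    (FiberBundle.extend E w) x
  have e : (koszulConnection g c).torsion x u v
      = koszulDeriv g c (FiberBundle.extend E v) x (FiberBundle.extend E u x)
        - koszulDeriv g c (FiberBundle.extend E u) x (FiberBundle.extend E v x)
        - VectorField.mlieBracket I (FiberBundle.extend E u) (FiberBundle.extend E v) x :=
    CovariantDerivative.torsion_apply_eq_extend _ u v
  simp only [FiberBundle.extend_apply_self] at h1 h2 h e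
  rw [e, map_sub, map_sub, sub_apply, sub_apply, h1, h2]
  linarith

theorem koszulDeriv_metric [FiniteDimensional ℝ E] (g : RiemMetric I M) (c : DiffForm I M 3)
    {Y Z : Π y : M, TangentSpace I y} {x : M} (hY : MDiffField Y x) (hZ : MDiffField Z x)
    (v : TangentSpace I x) :
    mvfderiv I (fun y => g.inner y (Y y) (Z y)) x v
      = g.inner x (koszulDeriv g c Y x v) (Z x) + g.inner x (Y x) (koszulDeriv g c Z x v) := by
  have hv := mdiffField_extend v
  have h1 := inner_koszulDeriv g c hv hY hZ
  have h2 := inner_koszulDeriv g c hv hZ hY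
  have h := koszul_metric g c (FiberBundle.extend E v) Y Z x
  simp only [FiberBundle.extend_apply_self] at h1 h2 h
  rw [g.symm x (Y x), h1, h2]
  linarith

theorem contMDiffAt_koszul [FiniteDimensional ℝ E] (g : RiemMetric I M) {c : DiffForm I M 3}
    {X Y Z : Π y : M, TangentSpace I y} {x : M} (hc : SmoothFormAt c x)
    (hX : SmoothField X x) (hY : SmoothField Y x) (hZ : SmoothField Z x) :
    ContMDiffAt I 𝓘(ℝ, ℝ) ∞ (koszul g c X Y Z) x := by
  have h : ContMDiffAt I 𝓘(ℝ, ℝ) ∞ (fun y => c y ![X y, Y y, Z y]) x := by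
    have h1 := hc ![X, Y, Z] (by intro i; fin_cases i <;> assumption)
    have e : (fun y => c y ![X y, Y y, Z y]) = fun y => c y (fun i => ![X, Y, Z] i y) := by
      funext y
      congr 1
      ext i
      fin_cases i <;> rfl
    rw [e]
    exact h1
  exact ((((((contMDiffAt_mvfderiv (contMDiffAt_inner g hY hZ) hX).add
    (contMDiffAt_mvfderiv (contMDiffAt_inner g hX hZ) hY)).sub
    (contMDiffAt_mvfderiv (contMDiffAt_inner g hX hY) hZ)).add
    (contMDiffAt_inner g (contMDiffAt_mlieBracket hX hY) hZ)).sub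
    (contMDiffAt_inner g (contMDiffAt_mlieBracket hX hZ) hY)).sub
    (contMDiffAt_inner g (contMDiffAt_mlieBracket hY hZ) hX)).add h

theorem koszulConnection_smooth [FiniteDimensional ℝ E] (g : RiemMetric I M) {c : DiffForm I M 3}
    (hc : ∀ x, SmoothFormAt c x) :
    CovariantDerivative.ContMDiffCovariantDerivative (koszulConnection g c) ∞ := by
  refine ⟨⟨fun {Y} hY x _ => ?_⟩⟩
  have hY' : SmoothField Y x := (hY x (mem_univ x)).contMDiffAt Filter.univ_mem
  refine ContMDiffAt.contMDiffWithinAt ?_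
  refine contMDiffAt_hom (F₁ := E) (F₂ := E) (koszulDeriv g c Y) x fun X hX => ?_
  refine smoothField_of_inner g fun Z hZ => ?_
  refine (contMDiffAt_const (c := (2 : ℝ)⁻¹)).mul
    (contMDiffAt_koszul g (hc x) hX hY' hZ) |>.congr_of_eventuallyEq ?_
  filter_upwards [eventually_mdifferentiableAt_section hX, eventually_mdifferentiableAt_section hY',
    eventually_mdifferentiableAt_section hZ] with y h1 h2 h3
  exact inner_koszulDeriv g c h1 h2 h3

namespace AlmostHermitian

variable (A : AlmostHermitian I M)

theorem inner_J_right (x : M) (a b : TangentSpace I x) :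
    A.g.inner x a (A.J x b) = -A.g.inner x (A.J x a) b := by
  rw [← A.compat x a, A.J_J, map_neg]

theorem smoothFormAt_fundForm (x : M) : SmoothFormAt A.fundForm x := fun _ hV =>
  contMDiffAt_inner A.g (SmoothField.endo A.smooth_J (hV 0)) (hV 1)

/-- The torsion form `dω(J ·, J ·, J ·)` of the Bismut connection. -/
def bismutForm : DiffForm I M 3 := fun x => (extD A.fundForm x).compContinuousLinearMap (A.J x)

theorem bismutForm_apply (x : M) (a b c : TangentSpace I x) :
    A.bismutForm x ![a, b, c] = extD A.fundForm x ![A.J x a, A.J x b, A.J x c] :=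
  congrArg (extD A.fundForm x) (by ext i; fin_cases i <;> rfl)

variable [FiniteDimensional ℝ E]

theorem smoothFormAt_bismutForm (x : M) : SmoothFormAt A.bismutForm x := fun V hV =>
  SmoothFormAt.extD A.smoothFormAt_fundForm (fun i y => A.J y (V i y))
    fun i => SmoothField.endo A.smooth_J (hV i)

theorem extD_fundForm {X Y Z : Π y : M, TangentSpace I y} {x : M} (hX : MDiffField X x)
    (hY : MDiffField Y x) (hZ : MDiffField Z x) :
    extD A.fundForm x ![X x, Y x, Z x] =
      mvfderiv I (fun y => A.g.inner y (A.J y (Y y)) (Z y)) x (X x)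
        - mvfderiv I (fun y => A.g.inner y (A.J y (X y)) (Z y)) x (Y x)
        + mvfderiv I (fun y => A.g.inner y (A.J y (X y)) (Y y)) x (Z x)
        - A.g.inner x (A.J x (VectorField.mlieBracket I X Y x)) (Z x)
        + A.g.inner x (A.J x (VectorField.mlieBracket I X Z x)) (Y x)
        - A.g.inner x (A.J x (VectorField.mlieBracket I Y Z x)) (X x) :=
  (A.smoothFormAt_fundForm x).extD_two hX hY hZ

theorem koszul_parallel (hA : A.IsIntegrable) {X Y Z : Π y : M, TangentSpace I y} {x : M}
    (hX : MDiffField X x) (hY : MDiffField Y x) (hZ : MDiffField Z x) :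
    koszul A.g A.bismutForm X (fun y => A.J y (Y y)) Z x
      + koszul A.g A.bismutForm X Y (fun y => A.J y (Z y)) x = 0 := by
  have hJX := hX.endo A.smooth_J
  have hJY := hY.endo A.smooth_J
  have hJZ := hZ.endo A.smooth_J
  have d1 := A.extD_fundForm hJX hY hJZ
  have d2 := A.extD_fundForm hJX hJY hZ
  have n1 := congrArg (fun v => A.g.inner x (A.J x v) (Z x)) (hA x X Y hX hY)
  have n2 := congrArg (fun v => A.g.inner x (A.J x v) (Y x)) (hA x X Z hX hZ)
  have c1 : A.bismutForm x ![X x, A.J x (Y x), Z x]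
      = -extD A.fundForm x ![A.J x (X x), Y x, A.J x (Z x)] := by
    rw [bismutForm_apply, A.J_J, ← neg_one_smul ℝ, map_smul_snd]
    ring
  have c2 : A.bismutForm x ![X x, Y x, A.J x (Z x)]
      = -extD A.fundForm x ![A.J x (X x), A.J x (Y x), Z x] := by
    rw [bismutForm_apply, A.J_J, ← neg_one_smul ℝ, map_smul_thd]
    ring
  simp only [koszul]
  rw [c1, c2, d1, d2]
  simp only [mvfderiv_fun_neg, neg_apply, A.inner_J_right, A.J_J, map_neg, map_sub,
    sub_apply, map_zero, zero_apply] at n1 n2 ⊢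
  linarith

theorem isKTConnection_koszulConnection (hA : A.IsIntegrable) :
    A.IsKTConnection (koszulConnection A.g A.bismutForm) A.bismutForm where
  smooth := koszulConnection_smooth A.g A.smoothFormAt_bismutForm
  metric _ _ _ v hY hZ := koszulDeriv_metric A.g A.bismutForm hY hZ v
  torsion := koszulDeriv_torsion A.g A.bismutForm
  parallel x Y v hY := by
    have hv := mdiffField_extend v
    refine eq_of_inner A.g fun Z hZ => ?_
    have h1 := inner_koszulDeriv A.g A.bismutForm hv (MDiffField.endo A.smooth_J hY) hZ.mdiff
    have h2 := inner_koszulDeriv A.g A.bismutForm hv hY (hZ.mdiff.endo A.smooth_J)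
    have h := A.koszul_parallel hA hv hY hZ.mdiff
    rw [FiberBundle.extend_apply_self] at h1 h2
    rw [A.inner_J_right] at h2
    change A.g.inner x (koszulDeriv A.g A.bismutForm (fun y => A.J y (Y y)) x v) (Z x)
      = A.g.inner x (A.J x (koszulDeriv A.g A.bismutForm Y x v)) (Z x)
    rw [h1]
    linarith

theorem isKTWithTorsion_bismutForm (hA : A.IsIntegrable) : A.IsKTWithTorsion A.bismutForm :=
  ⟨hA, _, A.isKTConnection_koszulConnection hA⟩

variable {A}

theorem IsKTConnection.torsion_apply {D : CovariantDerivative I E (fun x : M => TangentSpace I x)}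
    {c : DiffForm I M 3} (hD : A.IsKTConnection D c) {P Q : Π y : M, TangentSpace I y} {x : M}
    (hP : MDiffField P x) (hQ : MDiffField Q x) (w : TangentSpace I x) :
    c x ![P x, Q x, w] = A.g.inner x (D Q x (P x)) w - A.g.inner x (D P x (Q x)) w
      - A.g.inner x (VectorField.mlieBracket I P Q x) w := by
  rw [← hD.torsion, D.torsion_apply hP hQ]
  simp only [map_sub, sub_apply]

theorem IsKTConnection.extD_fundForm
    {D : CovariantDerivative I E (fun x : M => TangentSpace I x)} {c : DiffForm I M 3}
    (hD : A.IsKTConnection D c) (x : M) (p q r : TangentSpace I x) :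
    extD A.fundForm x ![p, q, r]
      = -c x ![p, q, A.J x r] - c x ![q, r, A.J x p] - c x ![r, p, A.J x q] := by
  obtain ⟨P, hP, rfl⟩ : ∃ P : Π y : M, TangentSpace I y, MDiffField P x ∧ P x = p :=
    ⟨_, mdiffField_extend p, FiberBundle.extend_apply_self ..⟩
  obtain ⟨Q, hQ, rfl⟩ : ∃ P : Π y : M, TangentSpace I y, MDiffField P x ∧ P x = q :=
    ⟨_, mdiffField_extend q, FiberBundle.extend_apply_self ..⟩
  obtain ⟨R, hR, rfl⟩ : ∃ P : Π y : M, TangentSpace I y, MDiffField P x ∧ P x = r :=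
    ⟨_, mdiffField_extend r, FiberBundle.extend_apply_self ..⟩
  have key : ∀ {U V : Π y : M, TangentSpace I y} (v : TangentSpace I x), MDiffField U x →
      MDiffField V x → mvfderiv I (fun y => A.g.inner y (A.J y (U y)) (V y)) x v
        = A.g.inner x (A.J x (D U x v)) (V x) - A.g.inner x (A.J x (D V x v)) (U x) :=
    fun {U V} v hU hV => by
      rw [hD.metric x _ V v (hU.endo A.smooth_J) hV, hD.parallel x U v hU,
        A.g.symm x (A.J x (U x)), A.inner_J_right, sub_eq_add_neg]
  rw [A.extD_fundForm hP hQ hR, key _ hQ hR, key _ hP hR, key _ hP hQ, hD.torsion_apply hP hQ,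
    hD.torsion_apply hQ hR, hD.torsion_apply hR hP,
    VectorField.mlieBracket_swap_apply (V := R) (W := P)]
  simp only [A.inner_J_right, map_neg, neg_apply]
  ring

theorem IsKTConnection.eq_bismutForm
    {D : CovariantDerivative I E (fun x : M => TangentSpace I x)} {c : DiffForm I M 3}
    (hA : A.IsIntegrable) (hD : A.IsKTConnection D c) : c = A.bismutForm := by
  funext x
  ext v
  obtain ⟨p, q, r, rfl⟩ : ∃ p q r, v = ![p, q, r] :=
    ⟨v 0, v 1, v 2, by ext i; fin_cases i <;> rfl⟩
  rw [bismutForm_apply, hD.extD_fundForm]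
  obtain ⟨P, hP, rfl⟩ : ∃ P : Π y : M, TangentSpace I y, MDiffField P x ∧ P x = p :=
    ⟨_, mdiffField_extend p, FiberBundle.extend_apply_self ..⟩
  obtain ⟨Q, hQ, rfl⟩ : ∃ P : Π y : M, TangentSpace I y, MDiffField P x ∧ P x = q :=
    ⟨_, mdiffField_extend q, FiberBundle.extend_apply_self ..⟩
  have hJP := hP.endo A.smooth_J
  have hJQ := hQ.endo A.smooth_J
  have n := congrArg (fun v => A.g.inner x v r) (hA x P Q hP hQ)
  have t1 := hD.torsion_apply hJP hJQ r
  have t2 := hD.torsion_apply hP hQ r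
  have t3 := hD.torsion_apply hJP hQ (A.J x r)
  have t4 := hD.torsion_apply hP hJQ (A.J x r)
  rw [hD.parallel x P _ hP, hD.parallel x Q _ hQ] at t1
  rw [hD.parallel x P _ hP] at t3
  rw [hD.parallel x Q _ hQ] at t4
  simp only [A.inner_J_right, A.J_J, map_neg, map_sub, sub_apply, neg_apply, map_zero,
    zero_apply] at n t1 t2 t3 t4 ⊢
  have s : ∀ a b d : TangentSpace I x, c x ![a, b, -d] = -c x ![a, b, d] := fun a b d => by
    rw [← neg_one_smul ℝ, map_smul_thd, neg_one_mul]
  rw [s, s, s, map_rotate (c x) (P x), ← map_rotate (c x) (A.J x r)]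
  linarith

end AlmostHermitian
end Hermitian

section TwoForm

variable {V : Type*} [AddCommGroup V] [Module ℝ V] [TopologicalSpace V]
  (c : V [⋀^Fin 2]→L[ℝ] ℝ) (a b b' : V) (r : ℝ)

theorem map_swap_two : c ![b, a] = -c ![a, b] := by
  have h := c.toAlternatingMap.map_swap ![a, b] (i := 0) (j := 1) (by decide)
  have e : ![a, b] ∘ Equiv.swap (0 : Fin 2) 1 = ![b, a] := by ext i; fin_cases i <;> rfl
  rw [e] at h
  exact h

theorem map_smul_right : c ![a, r • b] = r * c ![a, b] := by
  have h := c.map_update_smul ![a, b] 1 r b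
  have e : ∀ v, Function.update ![a, b] 1 v = ![a, v] := fun v => by
    ext i; fin_cases i <;> rfl
  rw [e, e] at h
  exact h

theorem map_add_right : c ![a, b + b'] = c ![a, b] + c ![a, b'] := by
  have h := c.map_update_add ![a, b] 1 b b'
  have e : ∀ v, Function.update ![a, b] 1 v = ![a, v] := fun v => by
    ext i; fin_cases i <;> rfl
  rw [e, e, e] at h
  exact h

theorem map_smul_left : c ![r • b, a] = r * c ![b, a] := by
  rw [map_swap_two, map_smul_right, map_swap_two c b, mul_neg, neg_neg]

theorem map_add_left : c ![b + b', a] = c ![b, a] + c ![b', a] := by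
  rw [map_swap_two, map_add_right, map_swap_two c b, map_swap_two c b', neg_add, neg_neg,
    neg_neg]

end TwoForm

section Derivation

variable {E : Type*} [NormedAddCommGroup E] [NormedSpace ℝ E]
  {H : Type*} [TopologicalSpace H] {I : ModelWithCorners ℝ E H}
  {M : Type*} [TopologicalSpace M] [ChartedSpace H M] [IsManifold I ∞ M]

theorem mvfderiv_symm_apply {f : M → ℝ} {W : Π y : M, TangentSpace I y} {x : M} {z : E}
    (hz : z ∈ (extChartAt I x).target)
    (hf : MDifferentiableAt I 𝓘(ℝ, ℝ) f ((extChartAt I x).symm z)) :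
    mvfderiv I f ((extChartAt I x).symm z) (W ((extChartAt I x).symm z))
      = fderivWithin ℝ (fun y => f ((extChartAt I x).symm y)) (range I) z (chartField W x z) := by
  have := isManifold_one (I := I) (M := M)
  have hzr : z ∈ range I := extChartAt_target_subset_range x hz
  have h1 := mfderiv_comp_mfderivWithin (x := z) hf
    (mdifferentiableWithinAt_extChartAt_symm hz) (I.uniqueMDiffOn z hzr)
  have h2 := congrArg (fun A : E →L[ℝ] ℝ => A (chartField W x z)) h1
  rw [← chartSymmD_chartField W x hz]
  refine Eq.trans ?_ (h2.symm.trans ?_)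
  · rfl
  · rw [mfderivWithin_eq_fderivWithin]
    rfl

theorem eq_of_mvfderiv {x : M} {u v : TangentSpace I x}
    (h : ∀ f : M → ℝ, ContMDiffAt I 𝓘(ℝ, ℝ) ∞ f x → mvfderiv I f x u = mvfderiv I f x v) :
    u = v := by
  have := isManifold_one (I := I) (M := M)
  refine (SeparatingDual.eq_iff_forall_dual_eq (R := ℝ) (V := E)).2 fun l => ?_
  have h1 : ContMDiffAt I 𝓘(ℝ, ℝ) ∞ (fun y => l (extChartAt I x y)) x :=
    l.contMDiff.contMDiffAt.comp x contMDiffAt_extChartAt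
  have key : ∀ w : TangentSpace I x, mvfderiv I (fun y => l (extChartAt I x y)) x w = l w := by
    intro w
    have h2 := mvfderiv_comp_apply (g := l) (f := extChartAt I x) x
      l.mdifferentiableAt (mdifferentiableAt_extChartAt (mem_chart_source H x)) w
    refine h2.trans ?_
    have h3 : mvfderiv 𝓘(ℝ, E) l (extChartAt I x x) = l := by
      rw [mvfderiv, mfderiv_eq_fderiv, l.fderiv]
      rfl
    rw [h3, mfderiv_extChartAt_self]
    rfl
  rw [← key u, ← key v]
  exact h _ h1

omit [IsManifold I ∞ M] in
theorem mvfderiv_congr {f f' : M → ℝ} {x : M} (h : f =ᶠ[𝓝 x] f') (v : TangentSpace I x) :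
    mvfderiv I f x v = mvfderiv I f' x v := by
  have h1 : mfderiv I 𝓘(ℝ, ℝ) f x = mfderiv I 𝓘(ℝ, ℝ) f' x := h.mfderiv_eq
  exact congrArg (fun A : E →L[ℝ] ℝ => A v) h1

theorem SmoothFormAt.apply_one {α : DiffForm I M 1} {x : M} (hα : SmoothFormAt α x)
    {X : Π y : M, TangentSpace I y} (hX : SmoothField X x) :
    ContMDiffAt I 𝓘(ℝ, ℝ) ∞ (fun y => α y ![X y]) x := by
  have e : (fun y => α y ![X y]) = fun y => α y (fun i => ![X] i y) := by
    funext y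
    congr 1
    ext i
    fin_cases i
    rfl
  rw [e]
  exact hα ![X] (by intro i; fin_cases i; exact hX)

variable [FiniteDimensional ℝ E]

theorem mvfderiv_mlieBracket {f : M → ℝ} {V W : Π y : M, TangentSpace I y} {x : M}
    (hf : ContMDiffAt I 𝓘(ℝ, ℝ) ∞ f x) (hV : SmoothField V x) (hW : SmoothField W x) :
    mvfderiv I f x (VectorField.mlieBracket I V W x)
      = mvfderiv I (fun y => mvfderiv I f y (W y)) x (V x)
        - mvfderiv I (fun y => mvfderiv I f y (V y)) x (W x) := by
  have hx : extChartAt I x x ∈ range I := mem_range_self _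
  have hF : ContDiffWithinAt ℝ ∞ (fun y => f ((extChartAt I x).symm y)) (range I)
      (extChartAt I x x) := (contMDiffAt_iff.1 hf).2
  set F := fun y => f ((extChartAt I x).symm y)
  have hsymm := hF.isSymmSndFDerivWithinAt (by simp; norm_cast) I.uniqueDiffOn
    (I.range_subset_closure_interior hx) hx
  have hF' : DifferentiableWithinAt ℝ (fderivWithin ℝ F (range I)) (range I)
      (extChartAt I x x) :=
    (hF.fderivWithin_right (m := ∞) I.uniqueDiffOn (by simp) hx).differentiableWithinAt (by simp)
  have hev : ∀ᶠ z in 𝓝[range I] (extChartAt I x x), z ∈ (extChartAt I x).target ∧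
      MDifferentiableAt I 𝓘(ℝ, ℝ) f ((extChartAt I x).symm z) := by
    refine Filter.Eventually.and (extChartAt_target_mem_nhdsWithin x) ?_
    have h1 : ∀ᶠ y in 𝓝 x, MDifferentiableAt I 𝓘(ℝ, ℝ) f y := by
      have := isManifold_one (I := I) (M := M)
      have h : ContMDiffAt I 𝓘(ℝ, ℝ) 1 f x := hf.of_le (by norm_cast)
      filter_upwards [(contMDiffAt_iff_contMDiffAt_nhds (by simp)).1 h] with z hz
      exact hz.mdifferentiableAt (by simp)
    have h2 := continuousAt_extChartAt_symm (I := I) x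
    rw [ContinuousAt, extChartAt_to_inv] at h2
    exact (h2.mono_left nhdsWithin_le_nhds).eventually h1
  have key : ∀ {U W : Π y : M, TangentSpace I y}, SmoothField U x → SmoothField W x →
      mvfderiv I (fun y => mvfderiv I f y (W y)) x (U x)
        = fderivWithin ℝ F (range I) (extChartAt I x x)
            (fderivWithin ℝ (chartField W x) (range I) (extChartAt I x x)
              (chartField U x (extChartAt I x x)))
          + fderivWithin ℝ (fderivWithin ℝ F (range I)) (range I) (extChartAt I x x)
            (chartField U x (extChartAt I x x)) (chartField W x (extChartAt I x x)) := by
    intro U W hU hW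
    rw [mvfderiv_eq ((contMDiffAt_mvfderiv hf hW).mdifferentiableAt (by simp))]
    have e : (fun z => mvfderiv I f ((extChartAt I x).symm z) (W ((extChartAt I x).symm z)))
        =ᶠ[𝓝[range I] (extChartAt I x x)]
        fun z => fderivWithin ℝ F (range I) z (chartField W x z) := by
      filter_upwards [hev] with z hz
      exact mvfderiv_symm_apply hz.1 hz.2
    have h2 := (e.fderivWithin_eq (e.eq_of_nhdsWithin hx)).trans
      (fderivWithin_clm_apply (I.uniqueDiffOn _ hx) hF' (differentiableWithinAt_chartField hW.mdiff))
    rw [chartField_self U]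
    exact congrArg (fun A : E →L[ℝ] ℝ => A (U x)) h2
  rw [key hV hW, key hW hV, mvfderiv_eq (hf.mdifferentiableAt (by simp)), mlieBracket_eq,
    VectorField.lieBracketWithin, hsymm.eq]
  refine (map_sub (fderivWithin ℝ F (range I) (extChartAt I x x)) _ _).trans ?_
  ring

theorem extD_extD_one {α : DiffForm I M 1} (hα : ∀ y, SmoothFormAt α y) (x : M) :
    extD (extD α) x = 0 := by
  ext u
  obtain ⟨X, hX, hXu⟩ : ∃ P : Π y : M, TangentSpace I y, SmoothField P x ∧ P x = u 0 :=
    ⟨_, smoothField_extend (u 0), FiberBundle.extend_apply_self ..⟩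
  obtain ⟨Y, hY, hYu⟩ : ∃ P : Π y : M, TangentSpace I y, SmoothField P x ∧ P x = u 1 :=
    ⟨_, smoothField_extend (u 1), FiberBundle.extend_apply_self ..⟩
  obtain ⟨Z, hZ, hZu⟩ : ∃ P : Π y : M, TangentSpace I y, SmoothField P x ∧ P x = u 2 :=
    ⟨_, smoothField_extend (u 2), FiberBundle.extend_apply_self ..⟩
  have hu : u = ![X x, Y x, Z x] := by
    rw [hXu, hYu, hZu]
    ext i
    fin_cases i <;> rfl
  have key : ∀ {U V : Π y : M, TangentSpace I y} (w : TangentSpace I x), SmoothField U x →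
      SmoothField V x → mvfderiv I (fun y => extD α y ![U y, V y]) x w
        = mvfderiv I (fun y => mvfderiv I (fun y => α y ![V y]) y (U y)) x w
          - mvfderiv I (fun y => mvfderiv I (fun y => α y ![U y]) y (V y)) x w
          - mvfderiv I (fun y => α y ![VectorField.mlieBracket I U V y]) x w := by
    intro U V w hU hV
    have e : (fun y => extD α y ![U y, V y]) =ᶠ[𝓝 x] fun y =>
        mvfderiv I (fun y => α y ![V y]) y (U y) - mvfderiv I (fun y => α y ![U y]) y (V y)
          - α y ![VectorField.mlieBracket I U V y] := by
      filter_upwards [eventually_mdifferentiableAt_section hU,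
        eventually_mdifferentiableAt_section hV] with y h1 h2
      exact (hα y).extD_one h1 h2
    have d1 := (contMDiffAt_mvfderiv ((hα x).apply_one hV) hU).mdifferentiableAt (by simp)
    have d2 := (contMDiffAt_mvfderiv ((hα x).apply_one hU) hV).mdifferentiableAt (by simp)
    have d3 := ((hα x).apply_one (contMDiffAt_mlieBracket hU hV)).mdifferentiableAt (by simp)
    have d12 : MDifferentiableAt I 𝓘(ℝ, ℝ) (fun y => mvfderiv I (fun y => α y ![V y]) y (U y)
      - mvfderiv I (fun y => α y ![U y]) y (V y)) x := d1.sub d2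
    rw [mvfderiv_congr e, mvfderiv_fun_sub d12 d3, mvfderiv_fun_sub d1 d2]
    rfl
  have hXY : SmoothField (VectorField.mlieBracket I X Y) x := contMDiffAt_mlieBracket hX hY
  have hXZ : SmoothField (VectorField.mlieBracket I X Z) x := contMDiffAt_mlieBracket hX hZ
  have hYZ : SmoothField (VectorField.mlieBracket I Y Z) x := contMDiffAt_mlieBracket hY hZ
  have : IsManifold I (minSmoothness ℝ 3) M :=
    IsManifold.of_le (n := ∞) (by simp; norm_cast)
  have hJ := VectorField.leibniz_identity_mlieBracket_apply
    (hX.of_le (by simp; norm_cast)) (hY.of_le (by simp; norm_cast)) (hZ.of_le (by simp; norm_cast))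
  have hneg : ∀ a : TangentSpace I x, α x ![-a] = -α x ![a] := fun a => by
    have h := (α x).map_update_smul ![a] 0 (-1) a
    have e : ∀ v, Function.update ![a] 0 v = ![v] := fun v => by
      ext i; fin_cases i; rfl
    rw [e, e, neg_one_smul, neg_one_smul] at h
    exact h
  have hadd : ∀ a b : TangentSpace I x, α x ![a + b] = α x ![a] + α x ![b] := fun a b => by
    have h := (α x).map_update_add ![a] 0 a b
    have e : ∀ v, Function.update ![a] 0 v = ![v] := fun v => by
      ext i; fin_cases i; rfl
    rw [e, e, e] at h
    exact h
  rw [hu, (SmoothFormAt.extD hα).extD_two hX.mdiff hY.mdiff hZ.mdiff, key _ hY hZ, key _ hX hZ,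
    key _ hX hY, (hα x).extD_one (X := VectorField.mlieBracket I X Y) hXY.mdiff hZ.mdiff,
    (hα x).extD_one (X := VectorField.mlieBracket I X Z) hXZ.mdiff hY.mdiff,
    (hα x).extD_one (X := VectorField.mlieBracket I Y Z) hYZ.mdiff hX.mdiff,
    mvfderiv_mlieBracket ((hα x).apply_one hZ) hX hY,
    mvfderiv_mlieBracket ((hα x).apply_one hY) hX hZ,
    mvfderiv_mlieBracket ((hα x).apply_one hX) hY hZ,
    VectorField.mlieBracket_swap_apply (V := VectorField.mlieBracket I X Z),
    VectorField.mlieBracket_swap_apply (V := VectorField.mlieBracket I Y Z), hJ, hneg, hneg, hadd]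
  refine Eq.trans ?_ (show (0 : ℝ) = _ from rfl)
  ring

end Derivation

section Contact

variable {E : Type*} [NormedAddCommGroup E] [NormedSpace ℝ E]
  {H : Type*} [TopologicalSpace H] {I : ModelWithCorners ℝ E H}
  {M : Type*} [TopologicalSpace M] [ChartedSpace H M] [IsManifold I ∞ M]

namespace AlmostContactMetric

variable (S : AlmostContactMetric I M)

theorem contMDiffAt_η {V : Π y : M, TangentSpace I y} {x : M} (hV : SmoothField V x) :
    ContMDiffAt I 𝓘(ℝ, ℝ) ∞ (fun y => S.η y (V y)) x :=
  contMDiffAt_inner S.g S.smooth_ξ.contMDiffAt hV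

theorem smoothFormAt_η (x : M) : SmoothFormAt (fun y => oneForm (S.η y)) x :=
  fun _ hV => S.contMDiffAt_η (hV 0)

theorem smoothFormAt_F (x : M) : SmoothFormAt S.F x := fun _ hV =>
  contMDiffAt_inner S.g (SmoothField.endo S.smooth_φ (hV 0)) (hV 1)

theorem F_apply (x : M) (a b : TangentSpace I x) : S.F x ![a, b] = S.g.inner x (S.φ x a) b := rfl

theorem inner_φ_right (x : M) (a b : TangentSpace I x) :
    S.g.inner x a (S.φ x b) = -S.g.inner x (S.φ x a) b := by
  have h := S.inner_φ_self x (a + b)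
  have h1 := S.inner_φ_self x a
  have h2 := S.inner_φ_self x b
  simp only [map_add, add_apply] at h
  rw [S.g.symm x a]
  linarith

theorem F_ξ_left (x : M) (a : TangentSpace I x) : S.F x ![S.ξ x, a] = 0 := by
  rw [F_apply, S.φ_ξ, map_zero, zero_apply]

theorem F_ξ_right (x : M) (a : TangentSpace I x) : S.F x ![a, S.ξ x] = 0 := by
  rw [F_apply, S.g.symm]
  exact S.η_φ x a

theorem F_φ_φ (x : M) (a b : TangentSpace I x) : S.F x ![S.φ x a, S.φ x b] = S.F x ![a, b] := by
  have h : S.g.inner x (S.ξ x) (S.φ x a) = 0 := S.η_φ x a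
  rw [F_apply, F_apply, S.compat, h, zero_mul, sub_zero]

theorem mvfderiv_η_ξ (x : M) : mvfderiv I (fun y => S.η y (S.ξ y)) x = 0 := by
  have e : (fun y => S.η y (S.ξ y)) = fun _ => 1 := funext fun y => S.η_ξ y
  rw [e, mvfderiv_const]

theorem mvfderiv_η_φ (X : Π y : M, TangentSpace I y) (x : M) :
    mvfderiv I (fun y => S.η y (S.φ y (X y))) x = 0 := by
  have e : (fun y => S.η y (S.φ y (X y))) = fun _ => 0 := funext fun y => S.η_φ y _
  rw [e, mvfderiv_const]

theorem dη_neg_right (x : M) (u v : TangentSpace I x) : S.dη x ![u, -v] = -S.dη x ![u, v] := by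
  rw [← neg_one_smul ℝ, map_smul_right, neg_one_mul]

variable [FiniteDimensional ℝ E]

theorem dη_apply {X Y : Π y : M, TangentSpace I y} {x : M} (hX : MDiffField X x)
    (hY : MDiffField Y x) :
    S.dη x ![X x, Y x] = mvfderiv I (fun y => S.η y (Y y)) x (X x)
      - mvfderiv I (fun y => S.η y (X y)) x (Y x) - S.η x (VectorField.mlieBracket I X Y x) :=
  (S.smoothFormAt_η x).extD_one hX hY

variable {S}

theorem IsKilling.dη_ξ_left (hK : S.IsKilling) (x : M) (v : TangentSpace I x) :
    S.dη x ![S.ξ x, v] = 0 := by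
  obtain ⟨V, hV, rfl⟩ : ∃ P : Π y : M, TangentSpace I y, SmoothField P x ∧ P x = v :=
    ⟨_, smoothField_extend v, FiberBundle.extend_apply_self ..⟩
  have hξ : SmoothField S.ξ x := S.smooth_ξ.contMDiffAt
  have h := hK x S.ξ V hξ.mdiff hV.mdiff
  rw [VectorField.mlieBracket_self, Pi.zero_apply, map_zero, zero_apply, zero_add] at h
  rw [S.dη_apply hξ.mdiff hV.mdiff, mvfderiv_η_ξ, zero_apply, sub_zero]
  exact sub_eq_zero.2 h

theorem IsST.mlieBracket_φ_ξ (hS : S.IsST) {X : Π y : M, TangentSpace I y} {x : M}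
    (hX : MDiffField X x) :
    VectorField.mlieBracket I (fun y => S.φ y (X y)) S.ξ x
      = S.φ x (VectorField.mlieBracket I X S.ξ x) := by
  have hξ : SmoothField S.ξ x := S.smooth_ξ.contMDiffAt
  have hφX := hX.endo S.smooth_φ
  have e : (fun y => S.φ y (S.ξ y)) = 0 := funext fun y => S.φ_ξ y
  have h := hS.1 x X S.ξ hX hξ.mdiff
  have h1 := hS.2.dη_ξ_left x (S.φ x (X x))
  rw [map_swap_two, S.dη_apply hφX hξ.mdiff, mvfderiv_η_ξ, mvfderiv_η_φ, zero_apply, zero_apply,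
    sub_self, zero_sub, neg_neg] at h1
  have h0 : ∀ Z : Π y : M, TangentSpace I y, VectorField.mlieBracket I Z 0 x = 0 := fun Z => by
    rw [VectorField.mlieBracket_zero_right]
    rfl
  rw [e, h0, h0, map_zero, map_swap_two, hS.2.dη_ξ_left, neg_zero, zero_smul, add_zero, sub_zero,
    zero_add] at h
  have h2 := congrArg (S.φ x) h
  have h3 : S.g.inner x (S.ξ x) (VectorField.mlieBracket I (fun y => S.φ y (X y)) S.ξ x) = 0 := h1
  have h4 : S.g.inner x (S.ξ x) (S.φ x (VectorField.mlieBracket I X S.ξ x)) = 0 := S.η_φ x _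
  rw [map_zero, map_sub, S.φ_φ, S.φ_φ, h3, h4, zero_smul, add_zero, add_zero,
    sub_neg_eq_add, neg_add_eq_zero] at h2
  exact h2.symm

theorem IsNormal.dη_φ_φ (hN : S.IsNormal) (x : M) (u v : TangentSpace I x) :
    S.dη x ![S.φ x u, S.φ x v] = S.dη x ![u, v] := by
  obtain ⟨U, hU, rfl⟩ : ∃ P : Π y : M, TangentSpace I y, SmoothField P x ∧ P x = u :=
    ⟨_, smoothField_extend u, FiberBundle.extend_apply_self ..⟩
  obtain ⟨V, hV, rfl⟩ : ∃ P : Π y : M, TangentSpace I y, SmoothField P x ∧ P x = v :=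
    ⟨_, smoothField_extend v, FiberBundle.extend_apply_self ..⟩
  have h := congrArg (S.η x) (hN x U V hU.mdiff hV.mdiff)
  rw [S.dη_apply (hU.endo S.smooth_φ).mdiff (hV.endo S.smooth_φ).mdiff, mvfderiv_η_φ, mvfderiv_η_φ,
    zero_apply, zero_apply]
  simp only [map_add, map_sub, map_smul, S.η_φ, S.η_ξ, smul_eq_mul, mul_one, map_zero] at h
  linarith

theorem IsST.dη_φ (hS : S.IsST) (x : M) (u v : TangentSpace I x) :
    S.dη x ![S.φ x u, v] + S.dη x ![u, S.φ x v] = 0 := by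
  have h := hS.1.dη_φ_φ x u (S.φ x v)
  rw [S.φ_φ, map_add_right, map_smul_right, dη_neg_right, map_swap_two _ (S.ξ x),
    hS.2.dη_ξ_left] at h
  linarith

theorem IsST.dF_ξ_left (hS : S.IsST) (x : M) (u v : TangentSpace I x) :
    extD S.F x ![S.ξ x, u, v] = 0 := by
  obtain ⟨U, hU, rfl⟩ : ∃ P : Π y : M, TangentSpace I y, SmoothField P x ∧ P x = u :=
    ⟨_, smoothField_extend u, FiberBundle.extend_apply_self ..⟩
  obtain ⟨V, hV, rfl⟩ : ∃ P : Π y : M, TangentSpace I y, SmoothField P x ∧ P x = v :=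
    ⟨_, smoothField_extend v, FiberBundle.extend_apply_self ..⟩
  have hξ : SmoothField S.ξ x := S.smooth_ξ.contMDiffAt
  have h1 := hS.2 x _ V (hU.endo S.smooth_φ).mdiff hV.mdiff
  have e1 : (fun y => S.F y ![S.ξ y, V y]) = fun _ => 0 := funext fun y => S.F_ξ_left y _
  have e2 : (fun y => S.F y ![S.ξ y, U y]) = fun _ => 0 := funext fun y => S.F_ξ_left y _
  have e3 : (fun y => S.F y ![U y, V y]) = fun y => S.g.inner y (S.φ y (U y)) (V y) := rfl
  rw [(S.smoothFormAt_F x).extD_two hξ.mdiff hU.mdiff hV.mdiff, e1, e2, e3, mvfderiv_const,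
    S.F_ξ_right, S.F_apply, S.F_apply, h1, VectorField.mlieBracket_swap_apply,
    hS.mlieBracket_φ_ξ hU.mdiff, VectorField.mlieBracket_swap_apply (V := S.ξ) (W := U),
    S.g.symm x (S.φ x (U x)), S.inner_φ_right]
  simp

end AlmostContactMetric

end Contact

section Lift

variable {E : Type*} [NormedAddCommGroup E] [NormedSpace ℝ E]
  {H : Type*} [TopologicalSpace H] {I : ModelWithCorners ℝ E H}
  {N : Type*} [TopologicalSpace N] [ChartedSpace H N]

omit [TopologicalSpace N] in
theorem radius_ne_zero (x : Cone N) : (x.1 : ℝ) ≠ 0 := (show (0 : ℝ) < x.1 from x.1.2).ne'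

theorem contMDiff_radius :
    ContMDiff (𝓘(ℝ, ℝ).prod I) 𝓘(ℝ, ℝ) ∞ (fun y : Cone N => (y.1 : ℝ)) :=
  contMDiff_subtype_val.comp contMDiff_fst

/-- The vector field `f r ∂/∂r + V` on the cone. -/
def coneLift (f : N → ℝ) (V : Π q : N, TangentSpace I q) :
    Π x : Cone N, TangentSpace (𝓘(ℝ, ℝ).prod I) x :=
  fun x => coneVec I x ((x.1 : ℝ) * f x.2, V x.2)

theorem exists_eq_coneVec (x : Cone N) (u : TangentSpace (𝓘(ℝ, ℝ).prod I) x) :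
    ∃ a v, u = coneVec I x ((x.1 : ℝ) * a, v) :=
  ⟨(x.1 : ℝ)⁻¹ * dr I x u, dπ I x u, by
    rw [mul_inv_cancel_left₀ (radius_ne_zero x), coneVec_dr_dπ]⟩

theorem mvfderiv_radius (x : Cone N) (u : TangentSpace (𝓘(ℝ, ℝ).prod I) x) :
    mvfderiv (𝓘(ℝ, ℝ).prod I) (fun y : Cone N => (y.1 : ℝ)) x u = dr I x u := rfl

theorem mdifferentiableAt_comp_snd {h : N → ℝ} {x : Cone N}
    (hh : MDifferentiableAt I 𝓘(ℝ, ℝ) h x.2) :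
    MDifferentiableAt (𝓘(ℝ, ℝ).prod I) 𝓘(ℝ, ℝ) (fun y : Cone N => h y.2) x :=
  MDifferentiableAt.comp x hh mdifferentiableAt_snd

theorem mvfderiv_comp_snd {h : N → ℝ} {x : Cone N} (hh : MDifferentiableAt I 𝓘(ℝ, ℝ) h x.2)
    (u : TangentSpace (𝓘(ℝ, ℝ).prod I) x) :
    mvfderiv (𝓘(ℝ, ℝ).prod I) (fun y : Cone N => h y.2) x u = mvfderiv I h x.2 (dπ I x u) :=
  mvfderiv_comp_apply (f := fun y : Cone N => y.2) x hh mdifferentiableAt_snd u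

theorem mvfderiv_radius_mul {h : N → ℝ} {x : Cone N} (hh : MDifferentiableAt I 𝓘(ℝ, ℝ) h x.2)
    (u : TangentSpace (𝓘(ℝ, ℝ).prod I) x) :
    mvfderiv (𝓘(ℝ, ℝ).prod I) (fun y : Cone N => (y.1 : ℝ) * h y.2) x u
      = (x.1 : ℝ) * mvfderiv I h x.2 (dπ I x u) + h x.2 * dr I x u := by
  have h1 := mvfderiv_fun_mul (contMDiff_radius.contMDiffAt.mdifferentiableAt (by simp))
    (mdifferentiableAt_comp_snd hh)
  rw [h1, ← mvfderiv_comp_snd hh]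
  rfl

theorem mvfderiv_sq_mul {h : N → ℝ} {x : Cone N} (hh : MDifferentiableAt I 𝓘(ℝ, ℝ) h x.2)
    (u : TangentSpace (𝓘(ℝ, ℝ).prod I) x) :
    mvfderiv (𝓘(ℝ, ℝ).prod I) (fun y : Cone N => (y.1 : ℝ) ^ 2 * h y.2) x u
      = (x.1 : ℝ) ^ 2 * mvfderiv I h x.2 (dπ I x u) + 2 * (x.1 : ℝ) * dr I x u * h x.2 := by
  have e : (fun y : Cone N => (y.1 : ℝ) ^ 2 * h y.2)
      = fun y : Cone N => (y.1 : ℝ) * ((y.1 : ℝ) * h y.2) := by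
    funext y
    ring
  have h0 : MDifferentiableAt (𝓘(ℝ, ℝ).prod I) 𝓘(ℝ, ℝ) (fun y : Cone N => (y.1 : ℝ)) x :=
    contMDiff_radius.contMDiffAt.mdifferentiableAt (by simp)
  have h2 : MDifferentiableAt (𝓘(ℝ, ℝ).prod I) 𝓘(ℝ, ℝ) (fun y : Cone N => (y.1 : ℝ) * h y.2) x :=
    h0.mul (mdifferentiableAt_comp_snd hh)
  have h3 : mvfderiv (𝓘(ℝ, ℝ).prod I) (fun y : Cone N => (y.1 : ℝ) * ((y.1 : ℝ) * h y.2)) x u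
      = (x.1 : ℝ) * mvfderiv (𝓘(ℝ, ℝ).prod I) (fun y : Cone N => (y.1 : ℝ) * h y.2) x u
        + (x.1 : ℝ) * h x.2 * dr I x u := by
    rw [mvfderiv_fun_mul h0 h2]
    rfl
  rw [e, h3, mvfderiv_radius_mul hh]
  ring

variable [IsManifold I ∞ N]

theorem smoothField_coneLift {f : N → ℝ} {V : Π q : N, TangentSpace I q} {x : Cone N}
    (hf : ContMDiffAt I 𝓘(ℝ, ℝ) ∞ f x.2) (hV : SmoothField V x.2) :
    SmoothField (coneLift f V) x := by
  have h1 : ContMDiffAt (𝓘(ℝ, ℝ).prod I) 𝓘(ℝ, ℝ) ∞ (fun y : Cone N => f y.2) x :=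
    hf.comp x contMDiffAt_snd
  have h2 : ContMDiffAt (𝓘(ℝ, ℝ).prod I) I.tangent ∞
      (fun y : Cone N => (⟨y.2, V y.2⟩ : TangentBundle I N)) x :=
    ContMDiffAt.comp x hV contMDiffAt_snd
  exact contMDiffAt_coneVec x _ _ (contMDiff_radius.contMDiffAt.mul h1) h2

variable [FiniteDimensional ℝ E]

theorem mlieBracket_coneLift {f g : N → ℝ} {V W : Π q : N, TangentSpace I q} {x : Cone N}
    (hf : ContMDiffAt I 𝓘(ℝ, ℝ) ∞ f x.2) (hg : ContMDiffAt I 𝓘(ℝ, ℝ) ∞ g x.2)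
    (hV : SmoothField V x.2) (hW : SmoothField W x.2) :
    VectorField.mlieBracket (𝓘(ℝ, ℝ).prod I) (coneLift f V) (coneLift g W) x
      = coneVec I x ((x.1 : ℝ) * (mvfderiv I g x.2 (V x.2) - mvfderiv I f x.2 (W x.2)),
          VectorField.mlieBracket I V W x.2) := by
  have hL := smoothField_coneLift hf hV
  have hL' := smoothField_coneLift hg hW
  rw [← coneVec_dr_dπ x (VectorField.mlieBracket _ _ _ x)]
  congr 2
  · have e : ∀ (k : N → ℝ) (U : Π q : N, TangentSpace I q),
        (fun y : Cone N => mvfderiv (𝓘(ℝ, ℝ).prod I) (fun y : Cone N => (y.1 : ℝ)) y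
          (coneLift k U y)) = fun y => (y.1 : ℝ) * k y.2 :=
      fun k U => funext fun y => dr_coneVec y _ _
    rw [← mvfderiv_radius, mvfderiv_mlieBracket contMDiff_radius.contMDiffAt hL hL', e, e,
      mvfderiv_radius_mul (hg.mdifferentiableAt (by simp)),
      mvfderiv_radius_mul (hf.mdifferentiableAt (by simp))]
    simp only [coneLift, dr_coneVec, dπ_coneVec]
    ring
  · refine eq_of_mvfderiv fun k hk => ?_
    have hk' : ContMDiffAt (𝓘(ℝ, ℝ).prod I) 𝓘(ℝ, ℝ) ∞ (fun y : Cone N => k y.2) x :=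
      hk.comp x contMDiffAt_snd
    have e : ∀ (f : N → ℝ) (U : Π q : N, TangentSpace I q),
        (fun y : Cone N => mvfderiv (𝓘(ℝ, ℝ).prod I) (fun y : Cone N => k y.2) y (coneLift f U y))
          =ᶠ[𝓝 x] fun y => mvfderiv I k y.2 (U y.2) := by
      intro f U
      have h1 : ∀ᶠ q in 𝓝 x.2, MDifferentiableAt I 𝓘(ℝ, ℝ) k q := by
        have := isManifold_one (I := I) (M := N)
        have h : ContMDiffAt I 𝓘(ℝ, ℝ) 1 k x.2 := hk.of_le (by norm_cast)
        filter_upwards [(contMDiffAt_iff_contMDiffAt_nhds (by simp)).1 h] with z hz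
        exact hz.mdifferentiableAt (by simp)
      filter_upwards [continuous_snd.continuousAt.eventually h1] with y hy
      rw [mvfderiv_comp_snd hy, coneLift, dπ_coneVec]
    have d : ∀ {U : Π q : N, TangentSpace I q}, SmoothField U x.2 →
        MDifferentiableAt I 𝓘(ℝ, ℝ) (fun q => mvfderiv I k q (U q)) x.2 :=
      fun hU => (contMDiffAt_mvfderiv hk hU).mdifferentiableAt (by simp)
    rw [← mvfderiv_comp_snd (hk.mdifferentiableAt (by simp)), mvfderiv_mlieBracket hk' hL hL',
      mvfderiv_congr (e g W), mvfderiv_congr (e f V), mvfderiv_comp_snd (d hW),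
      mvfderiv_comp_snd (d hV), mvfderiv_mlieBracket hk hV hW, coneLift, coneLift, dπ_coneVec,
      dπ_coneVec]

end Lift

section Nijenhuis

variable {E : Type*} [NormedAddCommGroup E] [NormedSpace ℝ E]
  {H : Type*} [TopologicalSpace H] {I : ModelWithCorners ℝ E H}
  {M : Type*} [TopologicalSpace M] [ChartedSpace H M] [IsManifold I ∞ M]

namespace AlmostHermitian

variable (A : AlmostHermitian I M)

/-- The Nijenhuis tensor of `J`. -/
def nijenhuis (X Y : Π y : M, TangentSpace I y) (x : M) : TangentSpace I x :=
  VectorField.mlieBracket I (fun y => A.J y (X y)) (fun y => A.J y (Y y)) x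
    - VectorField.mlieBracket I X Y x
    - A.J x (VectorField.mlieBracket I (fun y => A.J y (X y)) Y x)
    - A.J x (VectorField.mlieBracket I X (fun y => A.J y (Y y)) x)

theorem nijenhuis_swap (X Y : Π y : M, TangentSpace I y) (x : M) :
    A.nijenhuis Y X x = -A.nijenhuis X Y x := by
  simp only [nijenhuis]
  rw [VectorField.mlieBracket_swap_apply, VectorField.mlieBracket_swap_apply (V := Y),
    VectorField.mlieBracket_swap_apply (V := Y) (W := fun y => A.J y (X y)),
    VectorField.mlieBracket_swap_apply (V := fun y => A.J y (Y y)), map_neg, map_neg]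
  abel

variable [FiniteDimensional ℝ E]

theorem tensorialAt_nijenhuis_left (Y : Π y : M, TangentSpace I y) (x : M) :
    TensorialAt I E (fun X => A.nijenhuis X Y x) x where
  smul {f X} hf hX := by
    have e : (fun y => A.J y ((f • X) y)) = f • fun y => A.J y (X y) := by
      funext y
      exact map_smul ..
    have h := fun Z => VectorField.mlieBracket_smul_left (I := I) (W := Z) hf hX
    have hJ := fun Z => VectorField.mlieBracket_smul_left (I := I) (W := Z) hf
      (MDiffField.endo A.smooth_J hX)
    simp only [nijenhuis]
    rw [e, h, h, hJ, hJ]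
    simp only [map_add, map_smul, A.J_J]
    module
  add {X X'} hX hX' := by
    have e : (fun y => A.J y ((X + X') y)) = (fun y => A.J y (X y)) + fun y => A.J y (X' y) := by
      funext y
      exact map_add ..
    have h := fun Z => VectorField.mlieBracket_add_left (I := I) (W := Z) hX hX'
    have hJ := fun Z => VectorField.mlieBracket_add_left (I := I) (W := Z)
      (MDiffField.endo A.smooth_J hX) (MDiffField.endo A.smooth_J hX')
    simp only [nijenhuis]
    rw [e, h, h, hJ, hJ]
    simp only [map_add]
    abel

theorem tensorialAt_nijenhuis_right (X : Π y : M, TangentSpace I y) (x : M) :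
    TensorialAt I E (fun Y => A.nijenhuis X Y x) x := by
  have h := A.tensorialAt_nijenhuis_left X x
  refine ⟨fun {f Y} hf hY => ?_, fun {Y Y'} hY hY' => ?_⟩
  · rw [A.nijenhuis_swap _ X, A.nijenhuis_swap _ X, h.smul hf hY, smul_neg]
  · rw [A.nijenhuis_swap _ X, A.nijenhuis_swap _ X, A.nijenhuis_swap _ X, h.add hY hY', neg_add]

end AlmostHermitian

end Nijenhuis

section Cone

variable {E : Type*} [NormedAddCommGroup E] [NormedSpace ℝ E]
  {H : Type*} [TopologicalSpace H] {I : ModelWithCorners ℝ E H}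
  {N : Type*} [TopologicalSpace N] [ChartedSpace H N] [IsManifold I ∞ N]

namespace AlmostContactMetric

variable (S : AlmostContactMetric I N)

theorem coneJ_coneVec (x : Cone N) (a : ℝ) (v : TangentSpace I x.2) :
    S.coneJ x (coneVec I x ((x.1 : ℝ) * a, v))
      = coneVec I x ((x.1 : ℝ) * -S.η x.2 v, S.φ x.2 v + a • S.ξ x.2) := by
  rw [coneJ_apply, dπ_coneVec, dr_coneVec, inv_mul_cancel_left₀ (radius_ne_zero x), neg_mul,
    mul_neg]

theorem coneJ_coneLift (f : N → ℝ) (V : Π q : N, TangentSpace I q) :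
    (fun x => S.coneJ x (coneLift f V x))
      = coneLift (fun q => -S.η q (V q)) ((fun q => S.φ q (V q)) + f • S.ξ) :=
  funext fun x => S.coneJ_coneVec x (f x.2) (V x.2)

theorem mvfderiv_η_φ_add_ξ (V : Π q : N, TangentSpace I q) (a : ℝ) (x : N) :
    mvfderiv I (fun q => S.η q (((fun q => S.φ q (V q)) + a • S.ξ) q)) x = 0 := by
  have e : (fun q => S.η q (((fun q => S.φ q (V q)) + a • S.ξ) q)) = fun _ => a := by
    funext q
    rw [Pi.add_apply, map_add, S.η_φ, zero_add, Pi.smul_apply, map_smul, S.η_ξ, smul_eq_mul,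
      mul_one]
  rw [e, mvfderiv_const]

variable [FiniteDimensional ℝ E]

theorem mlieBracket_φ_add_ξ_left {V : Π q : N, TangentSpace I q} {x : N} (hV : SmoothField V x)
    (W : Π q : N, TangentSpace I q) (a : ℝ) :
    VectorField.mlieBracket I ((fun q => S.φ q (V q)) + a • S.ξ) W x
      = VectorField.mlieBracket I (fun q => S.φ q (V q)) W x
        - a • VectorField.mlieBracket I W S.ξ x := by
  have hξ : SmoothField S.ξ x := S.smooth_ξ.contMDiffAt
  have hφV := hV.endo S.smooth_φ
  have haξ : MDiffField (a • S.ξ) x := SmoothField.mdiff (hξ.const_smul_section (a := a))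
  rw [VectorField.mlieBracket_add_left hφV.mdiff haξ,
    VectorField.mlieBracket_const_smul_left hξ.mdiff,
    VectorField.mlieBracket_swap_apply (V := S.ξ), smul_neg, sub_eq_add_neg]

theorem mlieBracket_φ_add_ξ_right (V : Π q : N, TangentSpace I q) {W : Π q : N, TangentSpace I q}
    {x : N} (hW : SmoothField W x) (b : ℝ) :
    VectorField.mlieBracket I V ((fun q => S.φ q (W q)) + b • S.ξ) x
      = VectorField.mlieBracket I V (fun q => S.φ q (W q)) x
        + b • VectorField.mlieBracket I V S.ξ x := by
  rw [VectorField.mlieBracket_swap_apply, S.mlieBracket_φ_add_ξ_left hW,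
    VectorField.mlieBracket_swap_apply (V := V) (W := fun q => S.φ q (W q))]
  abel

variable {S} in
theorem IsST.mlieBracket_φ_add_ξ_ξ (hS : S.IsST) {V : Π q : N, TangentSpace I q} {x : N}
    (hV : SmoothField V x) (a : ℝ) :
    VectorField.mlieBracket I ((fun q => S.φ q (V q)) + a • S.ξ) S.ξ x
      = S.φ x (VectorField.mlieBracket I V S.ξ x) := by
  rw [S.mlieBracket_φ_add_ξ_left hV, VectorField.mlieBracket_self, hS.mlieBracket_φ_ξ hV.mdiff]
  exact (congrArg _ (smul_zero a)).trans (sub_zero _)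

variable {S} in
theorem IsST.mlieBracket_φ_add_ξ (hS : S.IsST) {V W : Π q : N, TangentSpace I q} {x : N}
    (hV : SmoothField V x) (hW : SmoothField W x) (a b : ℝ) :
    VectorField.mlieBracket I ((fun q => S.φ q (V q)) + a • S.ξ)
        ((fun q => S.φ q (W q)) + b • S.ξ) x
      = VectorField.mlieBracket I (fun q => S.φ q (V q)) (fun q => S.φ q (W q)) x
        - a • S.φ x (VectorField.mlieBracket I W S.ξ x)
        + b • S.φ x (VectorField.mlieBracket I V S.ξ x) := by
  rw [S.mlieBracket_φ_add_ξ_right _ hW, hS.mlieBracket_φ_add_ξ_ξ hV, S.mlieBracket_φ_add_ξ_left hV,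
    hS.mlieBracket_φ_ξ hW.mdiff]

theorem nijenhuis_coneLift (hS : S.IsST) {x : Cone N} {V W : Π q : N, TangentSpace I q}
    (hV : SmoothField V x.2) (hW : SmoothField W x.2) (a b : ℝ) :
    S.cone.nijenhuis (coneLift (fun _ => a) V) (coneLift (fun _ => b) W) x = 0 := by
  have hξ : SmoothField S.ξ x.2 := S.smooth_ξ.contMDiffAt
  have hφV := hV.endo S.smooth_φ
  have hφW := hW.endo S.smooth_φ
  have hV' : SmoothField ((fun q => S.φ q (V q)) + a • S.ξ) x.2 :=
    hφV.add_section (hξ.const_smul_section (a := a))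
  have hW' : SmoothField ((fun q => S.φ q (W q)) + b • S.ξ) x.2 :=
    hφW.add_section (hξ.const_smul_section (a := b))
  have ha : ContMDiffAt I 𝓘(ℝ, ℝ) ∞ (fun _ : N => a) x.2 := contMDiffAt_const
  have hb : ContMDiffAt I 𝓘(ℝ, ℝ) ∞ (fun _ : N => b) x.2 := contMDiffAt_const
  have hηV := (S.contMDiffAt_η hV).neg
  have hηW := (S.contMDiffAt_η hW).neg
  have e : S.cone.J = S.coneJ := rfl
  simp only [AlmostHermitian.nijenhuis, e]
  rw [S.coneJ_coneLift, S.coneJ_coneLift]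
  change VectorField.mlieBracket _ (coneLift _ ((fun q => S.φ q (V q)) + a • S.ξ))
    (coneLift _ ((fun q => S.φ q (W q)) + b • S.ξ)) x - _
    - S.coneJ x (VectorField.mlieBracket _ (coneLift _ ((fun q => S.φ q (V q)) + a • S.ξ)) _ x)
    - S.coneJ x (VectorField.mlieBracket _ _ (coneLift _ ((fun q => S.φ q (W q)) + b • S.ξ)) x)
    = 0
  rw [mlieBracket_coneLift hηV hηW hV' hW', mlieBracket_coneLift ha hb hV hW,
    mlieBracket_coneLift hηV hb hV' hW, mlieBracket_coneLift ha hηW hV hW', S.coneJ_coneVec,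
    S.coneJ_coneVec, ← map_sub, ← map_sub, ← map_sub, ← map_zero (coneVec I x)]
  congr 1
  refine Prod.ext ?_ ?_
  · have h1 := S.dη_apply hV'.mdiff hW.mdiff
    have h2 := S.dη_apply hV.mdiff hW'.mdiff
    have h3 := hS.dη_φ x.2 (V x.2) (W x.2)
    rw [S.mvfderiv_η_φ_add_ξ, zero_apply] at h1 h2
    simp only [Pi.add_apply, Pi.smul_apply, map_add_left, map_add_right, map_smul_left,
      map_smul_right, map_swap_two _ (S.ξ x.2) (V x.2), hS.2.dη_ξ_left] at h1 h2
    simp only [mvfderiv_fun_neg, mvfderiv_const, zero_apply, neg_apply, Prod.fst_sub, Prod.fst_zero,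
      Pi.add_apply, Pi.smul_apply]
    linear_combination (x.1 : ℝ) * h1 + (x.1 : ℝ) * h2 - (x.1 : ℝ) * h3
  · have h := hS.1 x.2 V W hV.mdiff hW.mdiff
    simp only [mvfderiv_fun_neg, mvfderiv_const, zero_apply, neg_apply, Prod.snd_sub, Prod.snd_zero,
      hS.mlieBracket_φ_add_ξ hV hW, S.mlieBracket_φ_add_ξ_left hV, S.mlieBracket_φ_add_ξ_right V hW,
      map_add, map_sub, map_smul]
    rw [S.dη_apply hV.mdiff hW.mdiff, S.φ_φ] at h
    have h' : S.g.inner x.2 (S.ξ x.2) (VectorField.mlieBracket I V W x.2)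
      = S.η x.2 (VectorField.mlieBracket I V W x.2) := rfl
    rw [h'] at h
    rw [← h]
    module

theorem isIntegrable_cone (hS : S.IsST) : S.cone.IsIntegrable := by
  intro x X Y hX hY
  have key : ∀ u : TangentSpace (𝓘(ℝ, ℝ).prod I) x, ∃ (a : ℝ) (V : Π q : N, TangentSpace I q),
      SmoothField V x.2 ∧ u = coneLift (fun _ => a) V x := fun u => by
    obtain ⟨a, v, rfl⟩ := exists_eq_coneVec x u
    exact ⟨a, FiberBundle.extend E v, smoothField_extend v, by
      rw [coneLift, FiberBundle.extend_apply_self]⟩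
  obtain ⟨a, V, hV, hXV⟩ := key (X x)
  obtain ⟨b, W, hW, hYW⟩ := key (Y x)
  have h := TensorialAt.pointwise₂ (Φ := fun X Y => S.cone.nijenhuis X Y x)
    (fun Y _ => S.cone.tensorialAt_nijenhuis_left Y x)
    (fun X _ => S.cone.tensorialAt_nijenhuis_right X x) hX
    (smoothField_coneLift contMDiffAt_const hV).mdiff hY
    (smoothField_coneLift contMDiffAt_const hW).mdiff hXV hYW
  exact h.trans (S.nijenhuis_coneLift hS hV hW a b)

end AlmostContactMetric

end Cone

section Wedge

variable {V : Type*} [AddCommGroup V] [Module ℝ V] [TopologicalSpace V]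

theorem wedge_one_apply (α β : V →L[ℝ] ℝ) (a b : V) :
    wedge α (oneForm β) ![a, b] = α a * β b - α b * β a := by
  rw [wedge_apply, Fin.sum_univ_two]
  have e0 : (0 : Fin 2).removeNth ![a, b] = ![b] := by ext i; fin_cases i; rfl
  have e1 : (1 : Fin 2).removeNth ![a, b] = ![a] := by ext i; fin_cases i; rfl
  have h : ∀ v : V, oneForm β ![v] = β v := fun _ => rfl
  rw [e0, e1, h, h]
  simp
  ring

theorem wedge_two_apply (α : V →L[ℝ] ℝ) (β : V [⋀^Fin 2]→L[ℝ] ℝ) (a b c : V) :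
    wedge α β ![a, b, c] = α a * β ![b, c] - α b * β ![a, c] + α c * β ![a, b] := by
  rw [wedge_apply, Fin.sum_univ_three]
  have e0 : (0 : Fin 3).removeNth ![a, b, c] = ![b, c] := by ext i; fin_cases i <;> rfl
  have e1 : (1 : Fin 3).removeNth ![a, b, c] = ![a, c] := by ext i; fin_cases i <;> rfl
  have e2 : (2 : Fin 3).removeNth ![a, b, c] = ![a, b] := by ext i; fin_cases i <;> rfl
  rw [e0, e1, e2]
  simp
  ring

theorem map_add_smul (β : V [⋀^Fin 3]→L[ℝ] ℝ) {z : V} (hz : ∀ u v, β ![z, u, v] = 0)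
    (u v w : V) (a b c : ℝ) : β ![u + a • z, v + b • z, w + c • z] = β ![u, v, w] := by
  have h2 : ∀ u v, β ![u, z, v] = 0 := fun u v => by rw [map_swap_left, hz, neg_zero]
  have h3 : ∀ u v, β ![u, v, z] = 0 := fun u v => by rw [map_swap_right, h2, neg_zero]
  simp only [map_add_fst, map_add_snd, map_add_thd, map_smul_fst, map_smul_snd, map_smul_thd, hz,
    h2, h3, mul_zero, add_zero]

end Wedge

section Cone

variable {E : Type*} [NormedAddCommGroup E] [NormedSpace ℝ E]
  {H : Type*} [TopologicalSpace H] {I : ModelWithCorners ℝ E H}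
  {N : Type*} [TopologicalSpace N] [ChartedSpace H N] [IsManifold I ∞ N]

omit [IsManifold I ∞ N] in
theorem extD_smul {k : ℕ} (r : ℝ) (α : DiffForm I N k) (x : N) :
    extD (fun y => r • α y) x = r • extD α x := by
  have h := extDerivWithin_fun_smul r (chartForm α x) (I.uniqueDiffOn _ (mem_range_self (chartAt H x x)))
  exact congrArg (fun β : E [⋀^Fin (k + 1)]→L[ℝ] ℝ =>
    β.compContinuousLinearMap (mfderiv I 𝓘(ℝ, E) (extChartAt I x) x : E →L[ℝ] E)) h

theorem SmoothFormAt.wedge_smooth {k : ℕ} {α : Π x : N, TangentSpace I x →L[ℝ] ℝ}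
    {β : DiffForm I N k} {x : N}
    (hα : ∀ V : Π y : N, TangentSpace I y, SmoothField V x →
      ContMDiffAt I 𝓘(ℝ, ℝ) ∞ (fun y => α y (V y)) x) (hβ : SmoothFormAt β x) :
    SmoothFormAt (fun y => wedge (α y) (β y)) x := by
  intro V hV
  simp only [wedge_apply]
  refine contMDiffAt_finsetSum fun i _ => contMDiffAt_const.mul ((hα _ (hV i)).mul ?_)
  exact hβ (fun j => V (i.succAbove j)) fun j => hV _

omit [IsManifold I ∞ N] in
theorem mvfderiv_linearCombination {f g k : N → ℝ} {q : N} (b c : ℝ)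
    (hf : MDifferentiableAt I 𝓘(ℝ, ℝ) f q) (hg : MDifferentiableAt I 𝓘(ℝ, ℝ) g q)
    (hk : MDifferentiableAt I 𝓘(ℝ, ℝ) k q) (v : TangentSpace I q) :
    mvfderiv I (fun p => b * f p - c * g p + k p) q v
      = b * mvfderiv I f q v - c * mvfderiv I g q v + mvfderiv I k q v := by
  have h1 : MDifferentiableAt I 𝓘(ℝ, ℝ) (fun p => b * f p) q := mdifferentiableAt_const.mul hf
  have h2 : MDifferentiableAt I 𝓘(ℝ, ℝ) (fun p => c * g p) q := mdifferentiableAt_const.mul hg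
  have h12 : MDifferentiableAt I 𝓘(ℝ, ℝ) (fun p => b * f p - c * g p) q := h1.sub h2
  rw [mvfderiv_fun_add h12 hk, mvfderiv_fun_sub h1 h2,
    mvfderiv_fun_mul mdifferentiableAt_const hf, mvfderiv_fun_mul mdifferentiableAt_const hg,
    mvfderiv_const, mvfderiv_const]
  simp

namespace AlmostContactMetric

variable (S : AlmostContactMetric I N)

/-- The `3`-form `η ∧ (dη - 2F) + d^φ F` on the base of the cone. -/
def baseTorsion : DiffForm I N 3 := fun x =>
  wedge (S.η x) (S.dη x - (2 : ℝ) • S.F x) + S.dφF x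

theorem baseTorsion_apply (x : N) (u v w : TangentSpace I x) :
    S.baseTorsion x ![u, v, w] = S.η x u * (S.dη x ![v, w] - 2 * S.F x ![v, w])
        - S.η x v * (S.dη x ![u, w] - 2 * S.F x ![u, w])
        + S.η x w * (S.dη x ![u, v] - 2 * S.F x ![u, v])
        + extD S.F x ![S.φ x u, S.φ x v, S.φ x w] := by
  have h : S.dφF x ![u, v, w] = extD S.F x ![S.φ x u, S.φ x v, S.φ x w] :=
    congrArg (extD S.F x) (by ext i; fin_cases i <;> rfl)
  have h' : S.baseTorsion x ![u, v, w]
    = wedge (S.η x) (S.dη x - (2 : ℝ) • S.F x) ![u, v, w] + S.dφF x ![u, v, w] := rfl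
  rw [h', h, wedge_two_apply]
  rfl

theorem coneTorsion_apply (x : Cone N) (y : Fin 3 → TangentSpace (𝓘(ℝ, ℝ).prod I) x) :
    S.coneTorsion x y = (x.1 : ℝ) ^ 2 * S.baseTorsion x.2 fun i => dπ I x (y i) := rfl

theorem coneTorsion_coneVec (x : Cone N) (a b c : ℝ) (u v w : TangentSpace I x.2) :
    S.coneTorsion x ![coneVec I x (a, u), coneVec I x (b, v), coneVec I x (c, w)]
      = (x.1 : ℝ) ^ 2 * S.baseTorsion x.2 ![u, v, w] := by
  rw [coneTorsion_apply]
  congr 2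
  ext i
  fin_cases i <;> exact dπ_coneVec ..

theorem coneTorsion_eq_zero_of_radial (x : Cone N) (y : Fin 3 → TangentSpace (𝓘(ℝ, ℝ).prod I) x)
    (i : Fin 3) (hi : dπ I x (y i) = 0) : S.coneTorsion x y = 0 := by
  rw [coneTorsion_apply, (S.baseTorsion x.2).map_coord_zero i hi, mul_zero]

theorem F_φ_add_ξ (x : N) (a b : ℝ) (u v : TangentSpace I x) :
    S.F x ![S.φ x u + a • S.ξ x, S.φ x v + b • S.ξ x] = S.F x ![u, v] := by
  simp only [map_add_left, map_add_right, map_smul_left, map_smul_right, S.F_ξ_left, S.F_ξ_right,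
    S.F_φ_φ]
  simp

variable [FiniteDimensional ℝ E]

theorem cone_fundForm_coneVec (x : Cone N) (a b : ℝ) (v w : TangentSpace I x.2) :
    S.cone.fundForm x ![coneVec I x ((x.1 : ℝ) * a, v), coneVec I x ((x.1 : ℝ) * b, w)]
      = (x.1 : ℝ) ^ 2 * (a * S.η x.2 w - b * S.η x.2 v + S.F x.2 ![v, w]) := by
  have h : S.cone.fundForm x ![coneVec I x ((x.1 : ℝ) * a, v), coneVec I x ((x.1 : ℝ) * b, w)]
    = coneInner I x (S.g.inner x.2) (S.coneJ x (coneVec I x ((x.1 : ℝ) * a, v)))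
      (coneVec I x ((x.1 : ℝ) * b, w)) := rfl
  have h' : S.g.inner x.2 (S.ξ x.2) w = S.η x.2 w := rfl
  rw [h, S.coneJ_coneVec, coneInner_apply, dr_coneVec, dr_coneVec, dπ_coneVec, dπ_coneVec, map_add,
    map_smul, add_apply, smul_apply, h', smul_eq_mul, S.F_apply]
  ring

theorem cone_fundForm (x : Cone N) : S.cone.fundForm x = S.coneForm x := by
  ext u
  obtain ⟨a, v, h0⟩ := exists_eq_coneVec x (u 0)
  obtain ⟨b, w, h1⟩ := exists_eq_coneVec x (u 1)
  have hu : u = ![coneVec I x ((x.1 : ℝ) * a, v), coneVec I x ((x.1 : ℝ) * b, w)] := by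
    rw [← h0, ← h1]
    ext i
    fin_cases i <;> rfl
  have h : S.coneForm x u = (x.1 : ℝ) * wedge (dr I x) (oneForm ((S.η x.2).comp (dπ I x))) u
      + (x.1 : ℝ) ^ 2 * S.F x.2 ![dπ I x (u 0), dπ I x (u 1)] := rfl
  rw [h, h0, h1, hu, S.cone_fundForm_coneVec, wedge_one_apply, dr_coneVec, dr_coneVec,
    ContinuousLinearMap.comp_apply, ContinuousLinearMap.comp_apply, dπ_coneVec, dπ_coneVec]
  ring

theorem extD_cone_fundForm_coneVec (x : Cone N) (a b c : ℝ) (u v w : TangentSpace I x.2) :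
    extD S.cone.fundForm x ![coneVec I x ((x.1 : ℝ) * a, u), coneVec I x ((x.1 : ℝ) * b, v),
        coneVec I x ((x.1 : ℝ) * c, w)]
      = (x.1 : ℝ) ^ 2 * (extD S.F x.2 ![u, v, w]
        - a * (S.dη x.2 ![v, w] - 2 * S.F x.2 ![v, w])
        + b * (S.dη x.2 ![u, w] - 2 * S.F x.2 ![u, w])
        - c * (S.dη x.2 ![u, v] - 2 * S.F x.2 ![u, v])) := by
  obtain ⟨U, hU, rfl⟩ : ∃ P : Π y : N, TangentSpace I y, SmoothField P x.2 ∧ P x.2 = u :=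
    ⟨_, smoothField_extend u, FiberBundle.extend_apply_self ..⟩
  obtain ⟨V, hV, rfl⟩ : ∃ P : Π y : N, TangentSpace I y, SmoothField P x.2 ∧ P x.2 = v :=
    ⟨_, smoothField_extend v, FiberBundle.extend_apply_self ..⟩
  obtain ⟨W, hW, rfl⟩ : ∃ P : Π y : N, TangentSpace I y, SmoothField P x.2 ∧ P x.2 = w :=
    ⟨_, smoothField_extend w, FiberBundle.extend_apply_self ..⟩
  have hc : ∀ a : ℝ, ContMDiffAt I 𝓘(ℝ, ℝ) ∞ (fun _ : N => a) x.2 := fun _ => contMDiffAt_const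
  have h := (S.cone.smoothFormAt_fundForm x).extD_two (smoothField_coneLift (hc a) hU).mdiff
    (smoothField_coneLift (hc b) hV).mdiff (smoothField_coneLift (hc c) hW).mdiff
  have d : ∀ {P Q : Π y : N, TangentSpace I y} (a b : ℝ)
      (y : TangentSpace (𝓘(ℝ, ℝ).prod I) x), SmoothField P x.2 → SmoothField Q x.2 →
      mvfderiv (𝓘(ℝ, ℝ).prod I) (fun y => S.cone.fundForm y ![coneLift (fun _ => a) P y,
          coneLift (fun _ => b) Q y]) x y
        = (x.1 : ℝ) ^ 2 * (a * mvfderiv I (fun q => S.η q (Q q)) x.2 (dπ I x y)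
            - b * mvfderiv I (fun q => S.η q (P q)) x.2 (dπ I x y)
            + mvfderiv I (fun q => S.F q ![P q, Q q]) x.2 (dπ I x y))
          + 2 * (x.1 : ℝ) * dr I x y * (a * S.η x.2 (Q x.2) - b * S.η x.2 (P x.2)
            + S.F x.2 ![P x.2, Q x.2]) := by
    intro P Q a b y hP hQ
    have e : (fun y => S.cone.fundForm y ![coneLift (fun _ => a) P y, coneLift (fun _ => b) Q y])
        = fun y : Cone N => (y.1 : ℝ) ^ 2 * (fun q => a * S.η q (Q q) - b * S.η q (P q)
          + S.F q ![P q, Q q]) y.2 :=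
      funext fun y => S.cone_fundForm_coneVec y a b (P y.2) (Q y.2)
    have h1 := (S.contMDiffAt_η hP).mdifferentiableAt (by simp)
    have h2 := (S.contMDiffAt_η hQ).mdifferentiableAt (by simp)
    have h3 : MDifferentiableAt I 𝓘(ℝ, ℝ) (fun q => S.F q ![P q, Q q]) x.2 :=
      mdifferentiableAt_inner S.g (hP.mdiff.endo S.smooth_φ) hQ.mdiff
    have h4 : MDifferentiableAt I 𝓘(ℝ, ℝ) (fun q => a * S.η q (Q q) - b * S.η q (P q)
          + S.F q ![P q, Q q]) x.2 :=
      MDifferentiableAt.add (MDifferentiableAt.sub (mdifferentiableAt_const.mul h2)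
        (mdifferentiableAt_const.mul h1)) h3
    rw [e, mvfderiv_sq_mul h4, mvfderiv_linearCombination a b h2 h1 h3]
  have br : ∀ {P Q R : Π y : N, TangentSpace I y} (a b c : ℝ), SmoothField P x.2 →
      SmoothField Q x.2 → S.cone.fundForm x ![VectorField.mlieBracket (𝓘(ℝ, ℝ).prod I)
        (coneLift (fun _ => a) P) (coneLift (fun _ => b) Q) x, coneLift (fun _ => c) R x]
      = (x.1 : ℝ) ^ 2 * (-c * S.η x.2 (VectorField.mlieBracket I P Q x.2)
        + S.F x.2 ![VectorField.mlieBracket I P Q x.2, R x.2]) := by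
    intro P Q R a b c hP hQ
    rw [mlieBracket_coneLift (hc a) (hc b) hP hQ, coneLift, S.cone_fundForm_coneVec, mvfderiv_const,
      mvfderiv_const]
    simp only [zero_apply]
    ring
  rw [d b c _ hV hW, d a c _ hU hW, d a b _ hU hV, br a b c hU hV, br a c b hU hW,
    br b c a hV hW] at h
  simp only [coneLift, dr_coneVec, dπ_coneVec] at h
  rw [h, (S.smoothFormAt_F x.2).extD_two hU.mdiff hV.mdiff hW.mdiff, S.dη_apply hV.mdiff hW.mdiff,
    S.dη_apply hU.mdiff hW.mdiff, S.dη_apply hU.mdiff hV.mdiff]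
  ring

variable {S} in
theorem IsST.extD_F_φ_add_ξ (hS : S.IsST) (x : N) (a b c : ℝ) (u v w : TangentSpace I x) :
    extD S.F x ![S.φ x u + a • S.ξ x, S.φ x v + b • S.ξ x, S.φ x w + c • S.ξ x]
      = extD S.F x ![S.φ x u, S.φ x v, S.φ x w] :=
  map_add_smul (extD S.F x) (hS.dF_ξ_left x) ..

variable {S} in
theorem IsST.dη_φ_add_ξ (hS : S.IsST) (x : N) (a b : ℝ) (u v : TangentSpace I x) :
    S.dη x ![S.φ x u + a • S.ξ x, S.φ x v + b • S.ξ x] = S.dη x ![u, v] := by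
  simp only [map_add_left, map_add_right, map_smul_left, map_smul_right, hS.2.dη_ξ_left,
    map_swap_two _ (S.ξ x) (S.φ x u), hS.1.dη_φ_φ]
  simp

variable {S} in
theorem IsST.cone_bismutForm (hS : S.IsST) : S.cone.bismutForm = S.coneTorsion := by
  funext x
  ext y
  obtain ⟨a, u, h0⟩ := exists_eq_coneVec x (y 0)
  obtain ⟨b, v, h1⟩ := exists_eq_coneVec x (y 1)
  obtain ⟨c, w, h2⟩ := exists_eq_coneVec x (y 2)
  have hy : y = ![coneVec I x ((x.1 : ℝ) * a, u), coneVec I x ((x.1 : ℝ) * b, v),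
      coneVec I x ((x.1 : ℝ) * c, w)] := by
    rw [← h0, ← h1, ← h2]
    ext i
    fin_cases i <;> rfl
  have e : S.cone.J = S.coneJ := rfl
  rw [hy, S.coneTorsion_coneVec, AlmostHermitian.bismutForm_apply, e, S.coneJ_coneVec,
    S.coneJ_coneVec, S.coneJ_coneVec, S.extD_cone_fundForm_coneVec, hS.extD_F_φ_add_ξ,
    hS.dη_φ_add_ξ, hS.dη_φ_add_ξ, hS.dη_φ_add_ξ, S.F_φ_add_ξ, S.F_φ_add_ξ, S.F_φ_add_ξ,
    S.baseTorsion_apply]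
  ring

theorem smoothFormAt_baseTorsion (x : N) : SmoothFormAt S.baseTorsion x := by
  have h : SmoothFormAt (fun y => S.dη y - (2 : ℝ) • S.F y) x := fun V hV =>
    (SmoothFormAt.extD S.smoothFormAt_η V hV).sub
      (contMDiffAt_const.mul (S.smoothFormAt_F x V hV))
  intro V hV
  exact (SmoothFormAt.wedge_smooth (fun _ hV => S.contMDiffAt_η hV) h V hV).add
    (SmoothFormAt.extD S.smoothFormAt_F (fun i y => S.φ y (V i y))
      fun i => SmoothField.endo S.smooth_φ (hV i))

variable {S} in
theorem IsST.extD_coneTorsion (hS : S.IsST) (x : Cone N) (u v w : TangentSpace I x.2) :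
    extD S.coneTorsion x ![coneVec I x (x.1, 0), coneVec I x (0, u), coneVec I x (0, v),
      coneVec I x (0, w)] = 2 * (x.1 : ℝ) ^ 2 * S.baseTorsion x.2 ![u, v, w] := by
  obtain ⟨U, hU, rfl⟩ : ∃ P : Π y : N, TangentSpace I y, SmoothField P x.2 ∧ P x.2 = u :=
    ⟨_, smoothField_extend u, FiberBundle.extend_apply_self ..⟩
  obtain ⟨V, hV, rfl⟩ : ∃ P : Π y : N, TangentSpace I y, SmoothField P x.2 ∧ P x.2 = v :=
    ⟨_, smoothField_extend v, FiberBundle.extend_apply_self ..⟩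
  obtain ⟨W, hW, rfl⟩ : ∃ P : Π y : N, TangentSpace I y, SmoothField P x.2 ∧ P x.2 = w :=
    ⟨_, smoothField_extend w, FiberBundle.extend_apply_self ..⟩
  have hO : SmoothField (fun q => (0 : TangentSpace I q)) x.2 := contMDiffAt_zeroSection ..
  have hc : ∀ a : ℝ, ContMDiffAt I 𝓘(ℝ, ℝ) ∞ (fun _ : N => a) x.2 := fun _ => contMDiffAt_const
  have hT : SmoothFormAt S.coneTorsion x := hS.cone_bismutForm ▸ S.cone.smoothFormAt_bismutForm x
  set L : Fin 4 → Π y : Cone N, TangentSpace (𝓘(ℝ, ℝ).prod I) y :=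
    ![coneLift (fun _ => 1) fun q => (0 : TangentSpace I q), coneLift (fun _ => 0) U,
      coneLift (fun _ => 0) V, coneLift (fun _ => 0) W] with hL
  have hLs : ∀ i, SmoothField (L i) x := by
    intro i
    fin_cases i
    exacts [smoothField_coneLift (hc 1) hO, smoothField_coneLift (hc 0) hU,
      smoothField_coneLift (hc 0) hV, smoothField_coneLift (hc 0) hW]
  have h := hT.extD_apply fun i => (hLs i).mdiff
  have hL0 : ∀ y, dπ I y (L 0 y) = 0 := fun y => dπ_coneVec y _ _
  have e : (fun i => L i x) = ![coneVec I x (x.1, 0), coneVec I x (0, U x.2),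
      coneVec I x (0, V x.2), coneVec I x (0, W x.2)] := by
    ext i
    fin_cases i
    · exact congrArg (fun r : ℝ => coneVec I x (r, 0)) (mul_one _)
    · exact congrArg (fun r : ℝ => coneVec I x (r, U x.2)) (mul_zero _)
    · exact congrArg (fun r : ℝ => coneVec I x (r, V x.2)) (mul_zero _)
    · exact congrArg (fun r : ℝ => coneVec I x (r, W x.2)) (mul_zero _)
  have hbr : ∀ j, dπ I x (VectorField.mlieBracket (𝓘(ℝ, ℝ).prod I) (L 0) (L j) x) = 0 := by
    have key : ∀ (a : ℝ) {Z : Π q : N, TangentSpace I q}, SmoothField Z x.2 →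
        dπ I x (VectorField.mlieBracket (𝓘(ℝ, ℝ).prod I) (L 0) (coneLift (fun _ => a) Z) x) = 0 := by
      intro a Z hZ
      have h1 := mlieBracket_coneLift (hc 1) (hc a) hO hZ
      refine (congrArg (dπ I x) h1).trans ((dπ_coneVec ..).trans ?_)
      exact congrFun (VectorField.mlieBracket_zero_left (I := I) (W := Z)) x.2
    intro j
    fin_cases j
    exacts [key 1 hO, key 0 hU, key 0 hV, key 0 hW]
  rw [← e, h, Finset.sum_eq_single 0, Finset.sum_eq_zero, sub_zero]
  · have e0 : (fun y => S.coneTorsion y ((0 : Fin 4).removeNth fun j => L j y))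
        = fun y : Cone N => (y.1 : ℝ) ^ 2 * (fun q => S.baseTorsion q fun i => ![U, V, W] i q) y.2 := by
      funext y
      rw [coneTorsion_apply]
      congr 2
      ext i
      fin_cases i <;> exact dπ_coneVec ..
    have hτ : MDifferentiableAt I 𝓘(ℝ, ℝ) (fun q => S.baseTorsion q fun i => ![U, V, W] i q) x.2 :=
      (S.smoothFormAt_baseTorsion x.2 ![U, V, W] fun i => by
        fin_cases i <;> assumption).mdifferentiableAt (by simp)
    have e1 : (fun i => ![U, V, W] i x.2) = ![U x.2, V x.2, W x.2] := by
      ext i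
      fin_cases i <;> rfl
    have h0 : dr I x (L 0 x) = x.1 := (dr_coneVec ..).trans (mul_one _)
    rw [e0, mvfderiv_sq_mul hτ, hL0, map_zero, h0, e1]
    simp only [Fin.val_zero, pow_zero]
    ring
  · intro i _
    refine Finset.sum_eq_zero fun j hj => ?_
    rw [mul_eq_zero]
    right
    by_cases hi : i = 0
    · subst hi
      exact S.coneTorsion_eq_zero_of_radial x _ 0 (hbr _)
    · refine S.coneTorsion_eq_zero_of_radial x _ 1 ?_
      have hj0 : j ≠ 0 := by
        rintro rfl
        exact hi (Fin.le_zero_iff.1 (Finset.mem_Ici.1 hj))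
      change dπ I x (L (i.castSucc.succAbove (j.succAbove 0)) x) = 0
      rw [Fin.succAbove_ne_zero_zero hj0, Fin.succAbove_ne_zero_zero (Fin.castSucc_ne_zero_iff.2 hi)]
      exact hL0 x
  · intro i _ hi
    have e0 : (fun y => S.coneTorsion y (i.removeNth fun j => L j y)) = fun _ => 0 := by
      funext y
      refine S.coneTorsion_eq_zero_of_radial y _ 0 ?_
      rw [Fin.removeNth_apply, Fin.succAbove_ne_zero_zero hi]
      exact hL0 y
    rw [e0, mvfderiv_const, zero_apply, mul_zero]
  · simp


variable {S} in
theorem IsST.isKTWithTorsion_cone (hS : S.IsST) : S.cone.IsKTWithTorsion S.coneTorsion :=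
  hS.cone_bismutForm ▸ S.cone.isKTWithTorsion_bismutForm (S.isIntegrable_cone hS)

variable {S} in
theorem IsST.isSasaki_of_baseTorsion_eq_zero (hS : S.IsST) (h : ∀ x, S.baseTorsion x = 0) :
    S.IsSasaki := by
  refine ⟨hS.1, fun x => ?_⟩
  ext y
  have hy : y = ![y 0, y 1] := by
    ext i
    fin_cases i <;> rfl
  have h1 := S.baseTorsion_apply x (S.ξ x) (y 0) (y 1)
  have h2 := hS.dF_ξ_left x
  rw [h, S.η_ξ, hS.2.dη_ξ_left, hS.2.dη_ξ_left, S.F_ξ_left, S.F_ξ_left, S.φ_ξ,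
    (extD S.F x).map_coord_zero 0 rfl, ← hy] at h1
  have h3 : (0 : ℝ) = S.dη x y - 2 * S.F x y := by
    refine Eq.trans ?_ (h1.trans ?_)
    · rfl
    · ring
  exact (sub_eq_zero.1 h3.symm)

variable {S} in
theorem IsST.isSasaki_of_isSKT (hS : S.IsST) (h : S.cone.IsSKT) : S.IsSasaki := by
  obtain ⟨c, ⟨hJ, D, hD⟩, hc⟩ := h
  rw [AlmostHermitian.IsKTConnection.eq_bismutForm hJ hD, hS.cone_bismutForm] at hc
  refine hS.isSasaki_of_baseTorsion_eq_zero fun q => ?_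
  ext y
  have hy : y = ![y 0, y 1, y 2] := by
    ext i
    fin_cases i <;> rfl
  let x : Cone N := (⟨1, mem_Ioi.2 one_pos⟩, q)
  have h1 := hS.extD_coneTorsion x (y 0) (y 1) (y 2)
  have h2 : (0 : ℝ) = 2 * (1 : ℝ) ^ 2 * S.baseTorsion q ![y 0, y 1, y 2] := by
    refine Eq.trans ?_ h1
    rw [hc]
    rfl
  rw [← hy] at h2
  have h3 : S.baseTorsion q y = 0 := by linarith
  exact h3

variable {S} in
theorem IsSasaki.baseTorsion_eq_zero (hS : S.IsSasaki) (x : N) : S.baseTorsion x = 0 := by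
  have hF : S.F = fun x => (2 : ℝ)⁻¹ • S.dη x := by
    funext x
    rw [hS.2, smul_smul, inv_mul_cancel₀ two_ne_zero, one_smul]
  have hdF : extD S.F x = 0 := by
    have h : extD S.dη x = 0 := extD_extD_one S.smoothFormAt_η x
    rw [hF, extD_smul, h, smul_zero]
  have hw : ∀ u v, S.dη x ![u, v] - 2 * S.F x ![u, v] = 0 := fun u v => by
    rw [hS.2]
    exact sub_self _
  ext y
  have hy : y = ![y 0, y 1, y 2] := by
    ext i
    fin_cases i <;> rfl
  rw [hy, S.baseTorsion_apply, hw, hw, hw, hdF]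
  change _ * 0 - _ * 0 + _ * 0 + (0 : ℝ) = 0
  ring

variable {S} in
theorem IsST.isSKT_of_isSasaki (hS : S.IsST) (h : S.IsSasaki) : S.cone.IsSKT := by
  refine ⟨S.coneTorsion, hS.isKTWithTorsion_cone, fun x => ?_⟩
  have h0 : S.coneTorsion = fun y => (0 : ℝ) • S.coneTorsion y := by
    funext x
    ext y
    rw [coneTorsion_apply, h.baseTorsion_eq_zero, zero_smul]
    exact mul_zero _
  rw [h0, extD_smul, zero_smul]

end AlmostContactMetric

end Cone

end TorsionGeometry

end

theorem mainTheorem7 {E : Type*} [NormedAddCommGroup E] [NormedSpace ℝ E] [FiniteDimensional ℝ E]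
    {H : Type*} [TopologicalSpace H] (I : ModelWithCorners ℝ E H) [I.Boundaryless]
    {N : Type*} [TopologicalSpace N] [ChartedSpace H N] [IsManifold I ∞ N]
    [T2Space N] [SecondCountableTopology N] (hodd : Odd (Module.finrank ℝ E))
    (S : AlmostContactMetric I N) (hS : S.IsST) :
    (∀ x, S.cone.fundForm x = S.coneForm x) ∧
    S.cone.IsKTWithTorsion S.coneTorsion ∧
    (S.cone.IsSKT ↔ S.IsSasaki) := by
  exact ⟨S.cone_fundForm, hS.isKTWithTorsion_cone, hS.isSasaki_of_isSKT, hS.isSKT_of_isSasaki⟩
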